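/- Let $d\in\mathbb N$ and let $V_0\in C^\infty(\mathbb R^d,\mathbb R)$ be such that $\nabla V_0$ is globally Lipschitz continuous. For $u\in\mathbb R^{d+1}$ set $$H_u(q,p)=\frac{|p|^2}{2}+V_0(q)+\sum_{j=1}^d u_jq_j+u_{d+1}e^{-|q|^2/2},\qquad (q,p)\in T^*\mathbb R^d=\mathbb R^d\times\mathbb R^d,$$ and, for a piecewise constant control $u:[0,\tau]\to\mathbb R^{d+1}$, let $\Phi^\tau_{H_u}$ be the flow at time $\tau$ (starting from time $0$) of the Hamilton equation $\dot q=\nabla_pH_{u(t)}(q,p)$, $\dot p=-\nabla_qH_{u(t)}(q,p)$. Call a Hamiltonian diffeomorphism $\Psi$ of $T^*\mathbb R^d$ (the time-one map of the flow of a smooth, possibly time-dependent Hamiltonian) small-time approximately reachable if for every $\varepsilon>0$, every compact $K\subset T^*\mathbb R^d$ and every $\ell\in\mathbb N$ there exist a time $\tau\in[0,\varepsilon]$ and a piecewise constant control $u:[0,\tau]\to\mathbb R^{d+1}$ such that $\|\Phi^\tau_{H_u}-\Psi\|_{C^\ell(K)}<\varepsilon$. Then, for every $f\in C^\infty(\mathbb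 R^d,\mathbb R)$, the vertical shear $(q,p)\mapsto(q,p-\nabla f(q))$ is a Hamiltonian diffeomorphism that is small-time approximately reachable. -/

import Mathlib

open scoped ContDiff NNReal

noncomputable section

/-- Configuration space `ℝ^d` with its Euclidean structure. -/
abbrev Config (d : ℕ) : Type := EuclideanSpace ℝ (Fin d)

/-- The phase space `T^*ℝ^d = ℝ^d_q × ℝ^d_p`; its points are pairs `(q, p)`. -/
abbrev Phase (d : ℕ) : Type := Config d × Config d

/-- The Hamiltonian vector field of `H`, namely `(q, p) ↦ (∇_p H(q, p), -∇_q H(q, p))`. -/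
def hamVectorField {d : ℕ} (H : Phase d → ℝ) (x : Phase d) : Phase d :=
  (gradient (fun p => H (x.1, p)) x.2, -gradient (fun q => H (q, x.2)) x.1)

/-- `Ψ` is a Hamiltonian diffeomorphism of `T^*ℝ^d`: it is the time-one map of the flow
`t ↦ φ_t` (smooth, by diffeomorphisms, with `φ_0 = id`) of a smooth, possibly time-dependent
Hamiltonian. -/
def IsHamiltonianDiffeo {d : ℕ} (Ψ : Phase d → Phase d) : Prop :=
  ∃ (H : ℝ → Phase d → ℝ) (φ : ℝ → Phase d ≃ Phase d),
    ContDiff ℝ ∞ (fun z : ℝ × Phase d => H z.1 z.2) ∧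
    ContDiff ℝ ∞ (fun z : ℝ × Phase d => φ z.1 z.2) ∧
    ContDiff ℝ ∞ (fun z : ℝ × Phase d => (φ z.1).symm z.2) ∧
    (∀ x, φ 0 x = x) ∧
    (∀ t x, HasDerivAt (fun s => φ s x) (hamVectorField (H t) (φ t x)) t) ∧
    (∀ x, φ 1 x = Ψ x)

/-- `u` is piecewise constant on `[0, τ]`: there are finitely many break points such that `u` is
constant on every subinterval of `[0, τ]` that contains none of them. -/
def IsPiecewiseConstant {m : ℕ} (τ : ℝ) (u : ℝ → Fin m → ℝ) : Prop :=
  ∃ S : Finset ℝ, ∀ s t : ℝ, 0 ≤ s → s ≤ t → t ≤ τ →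
    (∀ r ∈ S, r ∉ Set.Icc s t) → u s = u t

/-- `γ` is a solution on `[0, τ]` of the Hamilton equation `q' = ∇_p H_{u(t)}`,
`p' = -∇_q H_{u(t)}` driven by the piecewise constant control `u`: it is continuous and satisfies
the equation at all but finitely many times. -/
def IsTrajectory {d m : ℕ} (H : (Fin m → ℝ) → Phase d → ℝ) (τ : ℝ) (u : ℝ → Fin m → ℝ)
    (γ : ℝ → Phase d) : Prop :=
  ContinuousOn γ (Set.Icc 0 τ) ∧
    ∃ S : Finset ℝ, ∀ t ∈ Set.Ioo 0 τ, t ∉ S →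
      HasDerivAt γ (hamVectorField (H (u t)) (γ t)) t

/-- `Φ` is the flow map at time `τ` of the Hamilton equation with control `u`: from each `x` a
solution on `[0, τ]` starts, and `Φ x` is the end point of every such solution. -/
def IsFlowMap {d m : ℕ} (H : (Fin m → ℝ) → Phase d → ℝ) (τ : ℝ) (u : ℝ → Fin m → ℝ)
    (Φ : Phase d → Phase d) : Prop :=
  ∀ x y, Φ x = y ↔ ∃ γ : ℝ → Phase d, IsTrajectory H τ u γ ∧ γ 0 = x ∧ γ τ = y

/-- `‖Φ - Ψ‖_{C^ℓ(K)} < ε` for smooth maps on phase space: on the compact set `K`, all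
derivatives of `Φ - Ψ` of order at most `ℓ` are smaller than `ε`. -/
def IsCloseOn {d : ℕ} (ℓ : ℕ) (K : Set (Phase d)) (ε : ℝ) (Φ Ψ : Phase d → Phase d) : Prop :=
  ContDiff ℝ ∞ Φ ∧ ContDiff ℝ ∞ Ψ ∧
    ∀ k ≤ ℓ, ∀ x ∈ K, ‖iteratedFDeriv ℝ k (fun y => Φ y - Ψ y) x‖ < ε

/-- The set of Hamiltonian diffeomorphisms that are small-time approximately reachable for the
Hamilton equation with controlled Hamiltonian `H`. -/
def smallTimeApproxReachable {d m : ℕ} (H : (Fin m → ℝ) → Phase d → ℝ) :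
    Set (Phase d → Phase d) :=
  {Ψ | IsHamiltonianDiffeo Ψ ∧
    ∀ ε : ℝ, 0 < ε → ∀ K : Set (Phase d), IsCompact K → ∀ ℓ : ℕ,
      ∃ τ ∈ Set.Icc 0 ε, ∃ (u : ℝ → Fin m → ℝ) (Φ : Phase d → Phase d),
        IsPiecewiseConstant τ u ∧ IsFlowMap H τ u Φ ∧ IsCloseOn ℓ K ε Φ Ψ}

/-- The controlled Hamiltonian
`H_u(q, p) = |p|^2 / 2 + V₀(q) + ∑_{j=1}^d u_j q_j + u_{d+1} e^{-|q|^2 / 2}`. -/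
def euclideanHamiltonian {d : ℕ} (V₀ : Config d → ℝ) (u : Fin (d + 1) → ℝ) (x : Phase d) : ℝ :=
  ‖x.2‖ ^ 2 / 2 + V₀ x.1 + ∑ j : Fin d, u j.castSucc * x.1 j
    + u (Fin.last d) * Real.exp (-‖x.1‖ ^ 2 / 2)

/-- The set of vertical shears `(q, p) ↦ (q, p - ∇f(q))`, with `f` a smooth function on `ℝ^d`. -/
def verticalShears (d : ℕ) : Set (Phase d → Phase d) :=
  {Ψ | ∃ f : Config d → ℝ, ContDiff ℝ ∞ f ∧ Ψ = fun x => (x.1, x.2 - gradient f x.1)}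

end

/-!
Let `reachable` be the set of pairs `(τ, Φ)`, in `ℝ × C^∞(T^*ℝ^d, T^*ℝ^d)`, for which `Φ` is the
flow map at time `τ` of some piecewise constant control. With the `C^∞_loc` topology on smooth
maps, `Ψ` is small-time approximately reachable as soon as `(0, Ψ)` lies in the closure of
`reachable` (`exists_isCloseOn_of_mem_closure`). Concatenation of controls makes `reachable`
stable under `(s, Φ), (t, Ψ) ↦ (s + t, Ψ ∘ Φ)`, and composition is continuous, so the closure is
stable under the same operation (`add_comp_mem_closure_reachable`).

Three kinds of maps are then reached in time `0`.

* Shears of the potentials `g_u = ∑ u_j q_j + u_{d+1} e^{-|q|²/2}`: use the control `u / τ` during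
  the time `τ`. In rescaled time the equation is `q' = τ p`, `p' = -τ ∇V₀(q) - ∇g_u(q)`, which
  extends smoothly to `τ = 0`, where its time-one map is the shear (`shear_controlPotential_mem`).
  In particular all translations of the momentum are reached.
* Translations `(q, p) ↦ (q + a, p)`: a flight of duration `τ` without control, between momentum
  translations by `a / τ` and `-a / τ`, solves `q' = a + τ p`, `p' = -τ ∇V₀(q)` in rescaled time
  (`translate_position_mem`).
* Shears of translated Gaussians `c e^{-|q-a|²/2}`, by conjugating with translations
  (`shear_gaussian_mul_exp_mem`).

A translated Gaussian is `e^{-|q|²/2}` times an exponential `e^{a·q}` times a constant. The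
functions `h` for which the shear of `e^{-|q|²/2} h` is reached thus form a closed subset of
`C^∞(ℝ^d)` which is stable under addition and contains all multiples of the exponentials of linear
forms. Such a set is everything (`eq_univ_of_exp_mem`): a compactly supported function is the
limit of its convolutions with the normalised powers of a kernel `C - ∑ cosh z_i`, and these
convolutions are exponential sums.

The limits `τ → 0` rest on smooth dependence of solutions on parameters and initial values
(`contDiff_solution`), obtained by applying the implicit function theorem to the Picard operator
on `C([0, 1], E)`; it is smooth because superposition operators are (`contDiff_superposition`).
The implicit function theorem is applied under a Lipschitz bound `1/2`, which costs nothing here: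
the terms with factor `τ` are small, and the shear of `g_u` is a power of the shear of `g_{u/N}`.
-/

universe u

noncomputable section

/-! ### The `C^∞_loc` topology on smooth maps -/

section

open Filter Topology

section Convergence

variable {ι : Type*} {E F G F₁ F₂ : Type u}
  [NormedAddCommGroup E] [NormedSpace ℝ E] [NormedAddCommGroup F] [NormedSpace ℝ F]
  [NormedAddCommGroup G] [NormedSpace ℝ G] [NormedAddCommGroup F₁] [NormedSpace ℝ F₁]
  [NormedAddCommGroup F₂] [NormedSpace ℝ F₂]

/-- `C^k` convergence along `l`, in the form of continuous convergence of the derivatives of order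
at most `k`: `D^j f_i (y) → D^j f (x)` as `i → l` and `y → x`. For a limit of class `C^k` this is
locally uniform convergence of these derivatives. -/
def TendstoC (k : ℕ) (fs : ι → E → F) (l : Filter ι) (f : E → F) : Prop :=
  ∀ j ≤ k, ∀ x, Tendsto (fun p : ι × E => iteratedFDeriv ℝ j (fs p.1) p.2) (l ×ˢ 𝓝 x)
    (𝓝 (iteratedFDeriv ℝ j f x))

variable {l : Filter ι} {k : ℕ}

lemma tendsto_iteratedFDeriv_zero_iff {fs : ι → E → F} {f : E → F} {x : E} :
    Tendsto (fun p : ι × E => iteratedFDeriv ℝ 0 (fs p.1) p.2) (l ×ˢ 𝓝 x)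
      (𝓝 (iteratedFDeriv ℝ 0 f x)) ↔
    Tendsto (fun p : ι × E => fs p.1 p.2) (l ×ˢ 𝓝 x) (𝓝 (f x)) := by
  simp only [iteratedFDeriv_zero_eq_comp, Function.comp_apply]
  exact ((continuousMultilinearCurryFin0 ℝ E F).symm.toHomeomorph.isInducing.tendsto_nhds_iff).symm

lemma tendsto_iteratedFDeriv_succ_iff {fs : ι → E → F} {f : E → F} {x : E} {j : ℕ} :
    Tendsto (fun p : ι × E => iteratedFDeriv ℝ (j + 1) (fs p.1) p.2) (l ×ˢ 𝓝 x)
      (𝓝 (iteratedFDeriv ℝ (j + 1) f x)) ↔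
    Tendsto (fun p : ι × E => iteratedFDeriv ℝ j (fderiv ℝ (fs p.1)) p.2) (l ×ˢ 𝓝 x)
      (𝓝 (iteratedFDeriv ℝ j (fderiv ℝ f) x)) := by
  simp only [iteratedFDeriv_succ_eq_comp_right, Function.comp_apply]
  exact ((continuousMultilinearCurryRightEquiv' ℝ j E
    F).symm.toHomeomorph.isInducing.tendsto_nhds_iff).symm

lemma TendstoC.tendsto {fs : ι → E → F} {f : E → F} (h : TendstoC k fs l f) (x : E) :
    Tendsto (fun p : ι × E => fs p.1 p.2) (l ×ˢ 𝓝 x) (𝓝 (f x)) :=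
  tendsto_iteratedFDeriv_zero_iff.1 (h 0 (Nat.zero_le k) x)

lemma tendstoC_zero_iff {fs : ι → E → F} {f : E → F} :
    TendstoC 0 fs l f ↔
      ∀ x, Tendsto (fun p : ι × E => fs p.1 p.2) (l ×ˢ 𝓝 x) (𝓝 (f x)) := by
  refine ⟨fun h x => h.tendsto x, fun h j hj x => ?_⟩
  obtain rfl : j = 0 := by omega
  exact tendsto_iteratedFDeriv_zero_iff.2 (h x)

lemma tendstoC_succ_iff {fs : ι → E → F} {f : E → F} :
    TendstoC (k + 1) fs l f ↔
      (∀ x, Tendsto (fun p : ι × E => fs p.1 p.2) (l ×ˢ 𝓝 x) (𝓝 (f x))) ∧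
        TendstoC k (fun i => fderiv ℝ (fs i)) l (fderiv ℝ f) := by
  refine ⟨fun h => ⟨fun x => h.tendsto x, fun j hj x => ?_⟩, fun h j hj x => ?_⟩
  · exact tendsto_iteratedFDeriv_succ_iff.1 (h (j + 1) (by omega) x)
  · cases j with
    | zero => exact tendsto_iteratedFDeriv_zero_iff.2 (h.1 x)
    | succ j => exact tendsto_iteratedFDeriv_succ_iff.2 (h.2 j (by omega) x)

lemma TendstoC.of_succ {fs : ι → E → F} {f : E → F} (h : TendstoC (k + 1) fs l f) :
    TendstoC k fs l f := fun j hj => h j (by omega)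

lemma TendstoC.add {fs gs : ι → E → F} {f g : E → F} (hf : TendstoC k fs l f)
    (hg : TendstoC k gs l g) (hfs : ∀ i, ContDiff ℝ ∞ (fs i)) (hgs : ∀ i, ContDiff ℝ ∞ (gs i))
    (hfc : ContDiff ℝ ∞ f) (hgc : ContDiff ℝ ∞ g) :
    TendstoC k (fun i => fs i + gs i) l (f + g) := by
  intro j hj x
  have hle : (j : WithTop ℕ∞) ≤ ∞ := by exact_mod_cast le_top
  rw [iteratedFDeriv_add_apply (hfc.of_le hle).contDiffAt (hgc.of_le hle).contDiffAt]
  simp_rw [fun (i : ι) (y : E) => iteratedFDeriv_add_apply (x := y)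
    ((hfs i).of_le hle).contDiffAt ((hgs i).of_le hle).contDiffAt]
  exact (hf j hj x).add (hg j hj x)

/-- The product rule reduces `C^{k+1}` convergence of a product to `C^k` convergence of products of
the same kind, so no higher-order Leibniz formula is needed. -/
lemma TendstoC.bilinear (B : F₁ →L[ℝ] F₂ →L[ℝ] G) {fs : ι → E → F₁} {gs : ι → E → F₂} {f : E → F₁}
    {g : E → F₂} (hf : TendstoC k fs l f) (hg : TendstoC k gs l g)
    (hfs : ∀ i, ContDiff ℝ ∞ (fs i)) (hgs : ∀ i, ContDiff ℝ ∞ (gs i))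
    (hfc : ContDiff ℝ ∞ f) (hgc : ContDiff ℝ ∞ g) :
    TendstoC k (fun i x => B (fs i x) (gs i x)) l (fun x => B (f x) (g x)) := by
  induction k generalizing F₁ F₂ G with
  | zero =>
    rw [tendstoC_zero_iff]
    intro x
    exact (B.isBoundedBilinearMap.continuous.tendsto (f x, g x)).comp
      ((hf.tendsto x).prodMk_nhds (hg.tendsto x))
  | succ k ih =>
    rw [tendstoC_succ_iff]
    refine ⟨fun x => (B.isBoundedBilinearMap.continuous.tendsto (f x, g x)).comp
      ((hf.tendsto x).prodMk_nhds (hg.tendsto x)), ?_⟩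
    have hd : ∀ {a : E → F₁} {b : E → F₂}, ContDiff ℝ ∞ a → ContDiff ℝ ∞ b →
        fderiv ℝ (fun x => B (a x) (b x)) =
          (fun x => B.precompR E (a x) (fderiv ℝ b x)) +
            (fun x => B.precompL E (fderiv ℝ a x) (b x)) := by
      intro a b ha hb
      ext1 x
      exact (B.hasFDerivAt_of_bilinear (ha.differentiable (by simp) x).hasFDerivAt
        (hb.differentiable (by simp) x).hasFDerivAt).fderiv
    have hd' : ∀ {H : Type u} [NormedAddCommGroup H] [NormedSpace ℝ H] {a : E → H},
        ContDiff ℝ ∞ a → ContDiff ℝ ∞ (fderiv ℝ a) := fun ha => ha.fderiv_right (by simp)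
    have hB : ∀ {H₁ H₂ H : Type u} [NormedAddCommGroup H₁] [NormedSpace ℝ H₁]
        [NormedAddCommGroup H₂] [NormedSpace ℝ H₂] [NormedAddCommGroup H] [NormedSpace ℝ H]
        (B : H₁ →L[ℝ] H₂ →L[ℝ] H) {a : E → H₁} {b : E → H₂}, ContDiff ℝ ∞ a → ContDiff ℝ ∞ b →
        ContDiff ℝ ∞ fun x => B (a x) (b x) := fun B a b ha hb =>
      B.isBoundedBilinearMap.contDiff.comp (ha.prodMk hb)
    simp_rw [fun i => hd (hfs i) (hgs i), hd hfc hgc]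
    have hf' := (tendstoC_succ_iff.1 hf).2
    have hg' := (tendstoC_succ_iff.1 hg).2
    exact (ih (B.precompR E) hf.of_succ hg' hfs (fun i => hd' (hgs i)) hfc (hd' hgc)).add
      (ih (B.precompL E) hf' hg.of_succ (fun i => hd' (hfs i)) hgs (hd' hfc) hgc)
      (fun i => hB _ (hfs i) (hd' (hgs i))) (fun i => hB _ (hd' (hfs i)) (hgs i))
      (hB _ hfc (hd' hgc)) (hB _ (hd' hfc) hgc)

/-- By the chain rule `(f ∘ g)' = (f' ∘ g) · g'`, a composition with one derivative less followed by
a bilinear operation; iterating this replaces the Faà di Bruno formula. -/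
lemma TendstoC.comp {fs : ι → F → G} {gs : ι → E → F} {f : F → G} {g : E → F}
    (hf : TendstoC k fs l f) (hg : TendstoC k gs l g)
    (hfs : ∀ i, ContDiff ℝ ∞ (fs i)) (hgs : ∀ i, ContDiff ℝ ∞ (gs i))
    (hfc : ContDiff ℝ ∞ f) (hgc : ContDiff ℝ ∞ g) :
    TendstoC k (fun i => fs i ∘ gs i) l (f ∘ g) := by
  induction k generalizing G with
  | zero =>
    rw [tendstoC_zero_iff]
    exact fun x => (hf.tendsto (g x)).comp (tendsto_fst.prodMk (hg.tendsto x))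
  | succ k ih =>
    rw [tendstoC_succ_iff]
    refine ⟨fun x => (hf.tendsto (g x)).comp (tendsto_fst.prodMk (hg.tendsto x)), ?_⟩
    have hd : ∀ {a : F → G} {b : E → F}, ContDiff ℝ ∞ a → ContDiff ℝ ∞ b →
        fderiv ℝ (a ∘ b) =
          fun x => ContinuousLinearMap.compL ℝ E F G ((fderiv ℝ a ∘ b) x) (fderiv ℝ b x) := by
      intro a b ha hb
      ext1 x
      exact fderiv_comp x (ha.differentiable (by simp) _) (hb.differentiable (by simp) _)
    have hd' : ∀ {H K : Type u} [NormedAddCommGroup H] [NormedSpace ℝ H] [NormedAddCommGroup K]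
        [NormedSpace ℝ K] {a : K → H},
        ContDiff ℝ ∞ a → ContDiff ℝ ∞ (fderiv ℝ a) := fun ha => ha.fderiv_right (by simp)
    simp_rw [fun i => hd (hfs i) (hgs i), hd hfc hgc]
    have hf' := (tendstoC_succ_iff.1 hf).2
    have hg' := (tendstoC_succ_iff.1 hg).2
    exact (ih hf' hg.of_succ (fun i => hd' (hfs i)) (hd' hfc)).bilinear
      (ContinuousLinearMap.compL ℝ E F G) hg' (fun i => (hd' (hfs i)).comp (hgs i))
      (fun i => hd' (hgs i)) ((hd' hfc).comp hgc) (hd' hgc)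

end Convergence

/-- Smooth maps between normed spaces. -/
structure SmoothMap (E F : Type u) [NormedAddCommGroup E] [NormedSpace ℝ E]
    [NormedAddCommGroup F] [NormedSpace ℝ F] where
  /-- The underlying function. -/
  toFun : E → F
  contDiff : ContDiff ℝ ∞ toFun

namespace SmoothMap

variable {ι : Type*} {E F G : Type u}
  [NormedAddCommGroup E] [NormedSpace ℝ E] [NormedAddCommGroup F] [NormedSpace ℝ F]
  [NormedAddCommGroup G] [NormedSpace ℝ G]

instance : CoeFun (SmoothMap E F) (fun _ => E → F) := ⟨toFun⟩

@[ext] lemma ext {f g : SmoothMap E F} (h : ∀ x, f x = g x) : f = g := by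
  cases f; cases g; congr; exact funext h

/-- The derivative of order `k` of a smooth map, as a continuous map. -/
def jet (k : ℕ) (f : SmoothMap E F) : C(E, ContinuousMultilinearMap ℝ (fun _ : Fin k => E) F) :=
  ⟨iteratedFDeriv ℝ k f, f.contDiff.continuous_iteratedFDeriv (by exact_mod_cast le_top)⟩

/-- The `C^∞_loc` topology: locally uniform convergence of all derivatives. -/
instance : TopologicalSpace (SmoothMap E F) := ⨅ k, TopologicalSpace.induced (jet k) inferInstance

lemma continuous_jet (k : ℕ) : Continuous (jet k : SmoothMap E F → _) :=
  continuous_iff_le_induced.2 (iInf_le _ k)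

lemma tendsto_iff_jet {fs : ι → SmoothMap E F} {l : Filter ι} {f : SmoothMap E F} :
    Tendsto fs l (𝓝 f) ↔ ∀ k, Tendsto (fun i => jet k (fs i)) l (𝓝 (jet k f)) := by
  simp only [nhds_iInf, tendsto_iInf, nhds_induced, tendsto_comap_iff, Function.comp_def]

lemma tendsto_iff [FiniteDimensional ℝ E] {fs : ι → SmoothMap E F} {l : Filter ι}
    {f : SmoothMap E F} :
    Tendsto fs l (𝓝 f) ↔ ∀ k, TendstoC k (fun i => fs i) l f := by
  have : ProperSpace E := FiniteDimensional.proper_real E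
  rw [tendsto_iff_jet]
  have key : ∀ k, Tendsto (fun i => jet k (fs i)) l (𝓝 (jet k f)) ↔
      ∀ x, Tendsto (fun p : ι × E => iteratedFDeriv ℝ k (fs p.1) p.2) (l ×ˢ 𝓝 x)
        (𝓝 (iteratedFDeriv ℝ k f x)) := by
    intro k
    constructor
    · intro h x
      have h2 := (ContinuousEval.continuous_eval.tendsto (jet k f, x)).comp
        ((h.comp tendsto_fst).prodMk_nhds (tendsto_snd (f := l) (g := 𝓝 x)))
      exact h2
    · intro h
      rw [ContinuousMap.tendsto_iff_tendstoLocallyUniformly,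
        tendstoLocallyUniformly_iff_forall_tendsto]
      intro x
      have h1 : Tendsto (fun p : ι × E => jet k f p.2) (l ×ˢ 𝓝 x) (𝓝 (jet k f x)) :=
        ((jet k f).continuous.tendsto x).comp tendsto_snd
      exact (h1.prodMk_nhds (h x)).mono_right (nhds_le_uniformity _)
  simp only [key]
  exact ⟨fun h k j _ => h j, fun h k => h k k le_rfl⟩

/-- Composition of smooth maps. -/
def comp (f : SmoothMap F G) (g : SmoothMap E F) : SmoothMap E G :=
  ⟨f ∘ g, f.contDiff.comp g.contDiff⟩

@[simp] lemma comp_apply (f : SmoothMap F G) (g : SmoothMap E F) (x : E) :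
    f.comp g x = f (g x) := rfl

/-- Sum of smooth maps. -/
def add (f g : SmoothMap E F) : SmoothMap E F := ⟨f + g, f.contDiff.add g.contDiff⟩

@[simp] lemma add_apply (f g : SmoothMap E F) (x : E) : f.add g x = f x + g x := rfl

/-- Derivative of a smooth map. -/
def deriv (f : SmoothMap E F) : SmoothMap E (E →L[ℝ] F) :=
  ⟨fderiv ℝ f, f.contDiff.fderiv_right (by simp)⟩

@[simp] lemma deriv_apply (f : SmoothMap E F) (x : E) : f.deriv x = fderiv ℝ f x := rfl

/-- A continuous linear map, as a smooth map. -/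
def ofCLM (L : E →L[ℝ] F) : SmoothMap E F := ⟨L, L.contDiff⟩

@[simp] lemma ofCLM_apply (L : E →L[ℝ] F) (x : E) : ofCLM L x = L x := rfl

lemma continuous_comp [FiniteDimensional ℝ E] [FiniteDimensional ℝ F] :
    Continuous fun p : SmoothMap F G × SmoothMap E F => p.1.comp p.2 := by
  rw [continuous_iff_continuousAt]
  intro p
  rw [ContinuousAt, tendsto_iff]
  intro k
  have h₁ := tendsto_iff.1 (continuous_fst.tendsto p) k
  have h₂ := tendsto_iff.1 (continuous_snd.tendsto p) k
  exact h₁.comp h₂ (fun i => i.1.contDiff) (fun i => i.2.contDiff) p.1.contDiff p.2.contDiff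

lemma continuous_add [FiniteDimensional ℝ E] :
    Continuous fun p : SmoothMap E F × SmoothMap E F => p.1.add p.2 := by
  rw [continuous_iff_continuousAt]
  intro p
  rw [ContinuousAt, tendsto_iff]
  intro k
  have h₁ := tendsto_iff.1 (continuous_fst.tendsto p) k
  have h₂ := tendsto_iff.1 (continuous_snd.tendsto p) k
  exact h₁.add h₂ (fun i => i.1.contDiff) (fun i => i.2.contDiff) p.1.contDiff p.2.contDiff

lemma continuous_deriv [FiniteDimensional ℝ E] : Continuous (deriv : SmoothMap E F → _) := by
  rw [continuous_iff_continuousAt]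
  intro f
  rw [ContinuousAt, tendsto_iff]
  intro k
  exact (tendstoC_succ_iff.1 (tendsto_iff.1 (tendsto_id (x := 𝓝 f)) (k + 1))).2

/-- Product of smooth functions. -/
def mul {E : Type} [NormedAddCommGroup E] [NormedSpace ℝ E] (f g : SmoothMap E ℝ) :
    SmoothMap E ℝ :=
  ⟨fun x => f x * g x, f.contDiff.mul g.contDiff⟩

@[simp] lemma mul_apply {E : Type} [NormedAddCommGroup E] [NormedSpace ℝ E]
    (f g : SmoothMap E ℝ) (x : E) : f.mul g x = f x * g x := rfl

lemma continuous_mul {E : Type} [NormedAddCommGroup E] [NormedSpace ℝ E] [FiniteDimensional ℝ E] :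
    Continuous fun p : SmoothMap E ℝ × SmoothMap E ℝ => p.1.mul p.2 := by
  rw [continuous_iff_continuousAt]
  intro p
  rw [ContinuousAt, tendsto_iff]
  intro k
  have h₁ := tendsto_iff.1 (continuous_fst.tendsto p) k
  have h₂ := tendsto_iff.1 (continuous_snd.tendsto p) k
  exact h₁.bilinear (ContinuousLinearMap.mul ℝ ℝ) h₂ (fun i => i.1.contDiff)
    (fun i => i.2.contDiff) p.1.contDiff p.2.contDiff

lemma isClose_mem_nhds (f : SmoothMap E F) {K : Set E} (hK : IsCompact K) (m : ℕ) {ε : ℝ}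
    (hε : 0 < ε) :
    {g : SmoothMap E F | ∀ k ≤ m, ∀ x ∈ K,
      ‖iteratedFDeriv ℝ k g x - iteratedFDeriv ℝ k f x‖ < ε} ∈ 𝓝 f := by
  have h : ∀ k : ℕ, ∀ᶠ g in 𝓝 f, ∀ x ∈ K,
      ‖iteratedFDeriv ℝ k (g : SmoothMap E F) x - iteratedFDeriv ℝ k f x‖ < ε := by
    intro k
    have h1 := (continuous_jet (E := E) (F := F) k).tendsto f
    rw [ContinuousMap.tendsto_iff_forall_isCompact_tendstoUniformlyOn] at h1
    filter_upwards [Metric.tendstoUniformlyOn_iff.1 (h1 K hK) ε hε] with g hg x hx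
    rw [← dist_eq_norm, dist_comm]
    exact hg x hx
  have h2 := (Filter.eventually_all_finite (Set.finite_Iic m)).2 fun k _ => h k
  filter_upwards [h2] with g hg k hk x hx using hg k hk x hx

lemma mem_closure_of_approx [FiniteDimensional ℝ E] {S : Set (SmoothMap E F)} {f : SmoothMap E F}
    (h : ∀ K : Set E, IsCompact K → ∀ m : ℕ, ∀ ε : ℝ, 0 < ε → ∃ g ∈ S, ∀ k ≤ m, ∀ x ∈ K,
      ‖iteratedFDeriv ℝ k g x - iteratedFDeriv ℝ k f x‖ < ε) : f ∈ closure S := by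
  have : ProperSpace E := FiniteDimensional.proper_real E
  choose g hgS hg using fun n : ℕ => h (Metric.closedBall 0 n) (isCompact_closedBall 0 _) n
    (1 / (n + 1)) Nat.one_div_pos_of_nat
  refine mem_closure_of_tendsto (f := g) (b := atTop) ?_ (Eventually.of_forall hgS)
  rw [tendsto_iff_jet]
  intro k
  rw [ContinuousMap.tendsto_iff_forall_isCompact_tendstoUniformlyOn]
  intro K hK
  rw [Metric.tendstoUniformlyOn_iff]
  intro ε hε
  obtain ⟨R, hR⟩ := hK.isBounded.subset_closedBall 0
  filter_upwards [eventually_ge_atTop k, eventually_ge_atTop ⌈R⌉₊,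
    (tendsto_one_div_add_atTop_nhds_zero_nat (𝕜 := ℝ)).eventually_lt_const hε] with n hn hnR hnε
  intro x hx
  rw [dist_comm, dist_eq_norm]
  exact (hg n k hn x (Metric.closedBall_subset_closedBall
    ((Nat.le_ceil R).trans (by exact_mod_cast hnR)) (hR hx))).trans hnε

lemma contDiff_iteratedFDeriv_param {P : Type*} [NormedAddCommGroup P] [NormedSpace ℝ P] (k : ℕ)
    {f : P × E → G} (hf : ContDiff ℝ ∞ f) :
    ContDiff ℝ ∞ fun z : P × E => iteratedFDeriv ℝ k (fun y => f (z.1, y)) z.2 := by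
  induction k generalizing G with
  | zero =>
    simp only [iteratedFDeriv_zero_eq_comp, Function.comp_apply]
    exact (continuousMultilinearCurryFin0 ℝ E G).symm.contDiff.comp hf
  | succ k ih =>
    simp only [iteratedFDeriv_succ_eq_comp_right, Function.comp_apply]
    refine (continuousMultilinearCurryRightEquiv' ℝ k E G).symm.contDiff.comp
      (ih (f := fun z : P × E => fderiv ℝ (fun y => f (z.1, y)) z.2) ?_)
    refine ContDiff.fderiv (f := fun (z : P × E) y => f (z.1, y)) (m := ∞) ?_ contDiff_snd (by simp)
    exact hf.comp ((contDiff_fst.comp contDiff_fst).prodMk contDiff_snd)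

/-- The section `f (s, ·)` of a jointly smooth map. -/
def slice {P : Type*} [NormedAddCommGroup P] [NormedSpace ℝ P] {f : P × E → G}
    (hf : ContDiff ℝ ∞ f) (s : P) : SmoothMap E G :=
  ⟨fun x => f (s, x), hf.comp (contDiff_prodMk_right s)⟩

lemma continuous_slice {P : Type*} [NormedAddCommGroup P] [NormedSpace ℝ P] {f : P × E → G}
    (hf : ContDiff ℝ ∞ f) : Continuous (slice hf) := by
  rw [continuous_iInf_rng]
  intro k
  rw [continuous_induced_rng]
  exact (ContinuousMap.curry ⟨_, (contDiff_iteratedFDeriv_param k hf).continuous⟩).continuous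

end SmoothMap

end

section

open Filter Topology

/-! ### Superposition operators -/

section Superposition

variable {K : Type*} [TopologicalSpace K] {X Z : Type u}
  [NormedAddCommGroup X] [NormedSpace ℝ X] [NormedAddCommGroup Z] [NormedSpace ℝ Z]

/-- Pointwise application `(A, h) ↦ (t ↦ A t (h t))` as a continuous bilinear map. -/
def pointwiseApply [CompactSpace K] : C(K, X →L[ℝ] Z) →L[ℝ] C(K, X) →L[ℝ] C(K, Z) :=
  LinearMap.mkContinuous₂
    (LinearMap.mk₂ ℝ
      (fun (A : C(K, X →L[ℝ] Z)) (h : C(K, X)) =>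
        (⟨fun t => A t (h t), A.continuous.clm_apply h.continuous⟩ : C(K, Z)))
      (fun _ _ _ => by ext; simp) (fun _ _ _ => by ext; simp) (fun _ _ _ => by ext; simp)
      (fun _ _ _ => by ext; simp)) 1
    (fun A h => by
      rw [one_mul]
      refine (ContinuousMap.norm_le _ (mul_nonneg (norm_nonneg A) (norm_nonneg h))).2 fun t => ?_
      exact ((A t).le_opNorm (h t)).trans
        (mul_le_mul (A.norm_coe_le_norm t) (h.norm_coe_le_norm t) (norm_nonneg _) (norm_nonneg _)))

/-- The superposition (Nemytskii) operator `γ ↦ g ∘ γ` on continuous functions. -/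
def superposition (g : SmoothMap X Z) (γ : C(K, X)) : C(K, Z) :=
  (⟨g, g.contDiff.continuous⟩ : C(X, Z)).comp γ

@[simp] lemma superposition_apply (g : SmoothMap X Z) (γ : C(K, X)) (t : K) :
    superposition g γ t = g (γ t) := rfl

lemma continuous_superposition (g : SmoothMap X Z) :
    Continuous (superposition g : C(K, X) → C(K, Z)) :=
  ContinuousMap.continuous_postcomp _

/-- Uniformity in `t` of the first order expansion of `g` at `γ t` comes from the continuity at `γ`
of the superposition operator of `g'`. -/
lemma hasFDerivAt_superposition [CompactSpace K] (g : SmoothMap X Z) (γ : C(K, X)) :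
    HasFDerivAt (superposition g : C(K, X) → C(K, Z))
      (pointwiseApply (superposition g.deriv γ)) γ := by
  rw [hasFDerivAt_iff_isLittleO_nhds_zero, Asymptotics.isLittleO_iff]
  intro ε hε
  obtain ⟨δ, hδ, h⟩ := Metric.continuousAt_iff.1
    ((continuous_superposition (K := K) g.deriv).continuousAt (x := γ)) ε hε
  filter_upwards [Metric.ball_mem_nhds (0 : C(K, X)) hδ] with η hη
  rw [mem_ball_zero_iff] at hη
  refine (ContinuousMap.norm_le _ (by positivity)).2 fun t => ?_
  have hseg : ∀ z ∈ segment ℝ (γ t) (γ t + η t), ‖fderiv ℝ g z - fderiv ℝ g (γ t)‖ ≤ ε := by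
    rintro z hz
    rw [segment_eq_image'] at hz
    obtain ⟨θ, hθ, rfl⟩ := hz
    have hd : dist (γ + θ • η) γ < δ := by
      rw [dist_eq_norm, add_sub_cancel_left, norm_smul, Real.norm_of_nonneg hθ.1]
      exact (mul_le_of_le_one_left (norm_nonneg _) hθ.2).trans_lt hη
    have h2 := ((ContinuousMap.dist_lt_iff hε).1 (h hd) t).le
    rw [dist_eq_norm] at h2
    simpa using h2
  have := (convex_segment (γ t) (γ t + η t)).norm_image_sub_le_of_norm_fderiv_le' (𝕜 := ℝ)
    (f := g) (φ := fderiv ℝ g (γ t))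
    (fun z _ => g.contDiff.differentiable (by simp) z) hseg (left_mem_segment ℝ _ _)
    (right_mem_segment ℝ _ _)
  rw [add_sub_cancel_left] at this
  exact this.trans (mul_le_mul_of_nonneg_left (η.norm_coe_le_norm t) hε.le)

/-- Superposition operators are smooth, since the derivative of the operator of `g` is the operator
of `g'` followed by a continuous linear map. -/
lemma contDiff_superposition [CompactSpace K] (g : SmoothMap X Z) :
    ContDiff ℝ ∞ (superposition g : C(K, X) → C(K, Z)) := by
  rw [contDiff_infty]
  intro n
  induction n generalizing Z with
  | zero => exact contDiff_zero.2 (continuous_superposition g)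
  | succ n ih =>
    rw [show ((n + 1 : ℕ) : WithTop ℕ∞) = n + 1 by push_cast; rfl,
      contDiff_succ_iff_hasFDerivAt]
    exact ⟨_, pointwiseApply.contDiff.comp (ih g.deriv), hasFDerivAt_superposition g⟩

end Superposition

open unitInterval MeasureTheory

/-! ### Smooth dependence on parameters and initial values -/

section Picard

variable {E : Type} [NormedAddCommGroup E] [NormedSpace ℝ E]

/-- Extension of a continuous function on the unit interval by constants. -/
abbrev unitExtend {E : Type*} [TopologicalSpace E] (f : C(I, E)) : ℝ → E :=
  Set.IccExtend zero_le_one f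

lemma continuous_unitExtend {E : Type*} [TopologicalSpace E] (f : C(I, E)) :
    Continuous (unitExtend f) :=
  f.continuous.Icc_extend'

/-- The Volterra operator `f ↦ (t ↦ ∫₀ᵗ f)` on `C([0, 1], E)`. -/
def volterra : C(I, E) →L[ℝ] C(I, E) :=
  LinearMap.mkContinuous
    { toFun := fun f => ⟨fun t => ∫ s in (0 : ℝ)..t, unitExtend f s,
        (intervalIntegral.continuous_primitive
          (fun a b => (continuous_unitExtend f).intervalIntegrable a b) 0).comp
          continuous_subtype_val⟩
      map_add' := fun f g => by
        ext t
        simp only [ContinuousMap.coe_mk, ContinuousMap.add_apply]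
        rw [← intervalIntegral.integral_add ((continuous_unitExtend f).intervalIntegrable _ _)
          ((continuous_unitExtend g).intervalIntegrable _ _)]
        rfl
      map_smul' := fun c f => by
        ext t
        simp only [ContinuousMap.coe_mk, ContinuousMap.smul_apply, RingHom.id_apply]
        rw [← intervalIntegral.integral_smul]
        rfl } 1
    (fun f => by
      rw [one_mul]
      refine (ContinuousMap.norm_le _ (norm_nonneg _)).2 fun t => ?_
      refine (intervalIntegral.norm_integral_le_of_norm_le_const (C := ‖f‖)
        fun s _ => f.norm_coe_le_norm _).trans ?_
      rw [sub_zero, abs_of_nonneg t.2.1]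
      exact mul_le_of_le_one_right (norm_nonneg _) t.2.2)

lemma volterra_apply (f : C(I, E)) (t : I) : volterra f t = ∫ s in (0 : ℝ)..t, unitExtend f s := rfl

lemma norm_volterra_le : ‖(volterra : C(I, E) →L[ℝ] C(I, E))‖ ≤ 1 :=
  LinearMap.mkContinuous_norm_le _ zero_le_one _

/-- Constant functions, as a continuous linear map. -/
def constCLM {F : Type*} [NormedAddCommGroup F] [NormedSpace ℝ F] : F →L[ℝ] C(I, F) :=
  LinearMap.mkContinuous
    { toFun := ContinuousMap.const I
      map_add' := fun _ _ => rfl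
      map_smul' := fun _ _ => rfl } 1
    (fun x => by
      rw [one_mul]
      exact (ContinuousMap.norm_le _ (norm_nonneg _)).2 fun _ => le_rfl)

@[simp] lemma constCLM_apply {F : Type*} [NormedAddCommGroup F] [NormedSpace ℝ F] (x : F) (t : I) :
    constCLM x t = x := rfl

/-- Pairing of a constant with a function, as a continuous linear map. -/
def constPair : ℝ × C(I, E) →L[ℝ] C(I, ℝ × E) :=
  ContinuousLinearMap.compLeftContinuous ℝ I (ContinuousLinearMap.inl ℝ ℝ E) ∘L constCLM ∘L
      ContinuousLinearMap.fst ℝ _ _ +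
    ContinuousLinearMap.compLeftContinuous ℝ I (ContinuousLinearMap.inr ℝ ℝ E) ∘L
      ContinuousLinearMap.snd ℝ _ _

@[simp] lemma constPair_apply (s : ℝ) (γ : C(I, E)) (t : I) : constPair (s, γ) t = (s, γ t) := by
  simp [constPair]

/-- The Picard operator `(s, x, γ) ↦ x + ∫₀ᵗ Y(s, γ)` of the equation `γ' = Y(s, γ)`, `γ(0) = x`. -/
def picardOp (Y : SmoothMap (ℝ × E) E) (z : (ℝ × E) × C(I, E)) : C(I, E) :=
  constCLM z.1.2 + volterra (superposition Y (constPair (z.1.1, z.2)))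

lemma picardOp_apply (Y : SmoothMap (ℝ × E) E) (z : (ℝ × E) × C(I, E)) (t : I) :
    picardOp Y z t = z.1.2 + ∫ r in (0 : ℝ)..t, Y (z.1.1, unitExtend z.2 r) := by
  simp [picardOp, volterra_apply, Set.IccExtend]

lemma contDiff_picardOp (Y : SmoothMap (ℝ × E) E) : ContDiff ℝ ∞ (picardOp Y) := by
  unfold picardOp
  have h1 : ContDiff ℝ ∞ fun z : (ℝ × E) × C(I, E) => constPair (z.1.1, z.2) :=
    (constPair (E := E)).contDiff.comp ((contDiff_fst.comp contDiff_fst).prodMk contDiff_snd)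
  exact (constCLM.contDiff.comp (contDiff_snd.comp contDiff_fst)).add
    (volterra.contDiff.comp ((contDiff_superposition Y).comp h1))

variable {Y : SmoothMap (ℝ × E) E} (hY : ∀ s, LipschitzWith (1 / 2) fun x => Y (s, x))
include hY

lemma lipschitzWith_picardOp (w : ℝ × E) : LipschitzWith (1 / 2) fun γ => picardOp Y (w, γ) := by
  refine LipschitzWith.of_dist_le_mul fun γ η => ?_
  rw [dist_eq_norm, picardOp, picardOp, add_sub_add_left_eq_sub, ← map_sub]
  refine ((volterra (E := E)).le_of_opNorm_le norm_volterra_le _).trans ?_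
  rw [one_mul]
  refine (ContinuousMap.norm_le _ (by positivity)).2 fun t => ?_
  have := (hY w.1).dist_le_mul (γ t) (η t)
  rw [dist_eq_norm] at this
  simp only [ContinuousMap.sub_apply, superposition_apply, constPair_apply]
  exact this.trans (mul_le_mul_of_nonneg_left (ContinuousMap.dist_apply_le_dist t) (by positivity))

lemma contractingWith_picardOp (w : ℝ × E) : ContractingWith (1 / 2) fun γ => picardOp Y (w, γ) :=
  ⟨by rw [← NNReal.coe_lt_coe]; norm_num, lipschitzWith_picardOp hY w⟩

variable [CompleteSpace E]

/-- The solution on `[0, 1]` of `γ' = Y(s, γ)`, `γ(0) = x`, for `Y(s, ·)` with Lipschitz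
constant `1/2`. -/
def solution (w : ℝ × E) : C(I, E) := (contractingWith_picardOp hY w).fixedPoint _

lemma picardOp_solution (w : ℝ × E) : picardOp Y (w, solution hY w) = solution hY w :=
  (contractingWith_picardOp hY w).fixedPoint_isFixedPt

lemma eq_solution {w : ℝ × E} {γ : C(I, E)} (h : picardOp Y (w, γ) = γ) : γ = solution hY w :=
  (contractingWith_picardOp hY w).fixedPoint_unique h

/-- Smooth dependence on parameter and initial value, by the implicit function theorem in
`C([0, 1], E)`: the partial derivative in `γ` of the Picard operator has norm at most `1/2`. -/
lemma contDiff_solution : ContDiff ℝ ∞ (solution hY) := by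
  rw [contDiff_iff_contDiffAt]
  intro w
  let f : (ℝ × E) × C(I, E) → C(I, E) := fun z => z.2 - picardOp Y z
  have hf : ContDiff ℝ ∞ f := contDiff_snd.sub (contDiff_picardOp Y)
  let D := fderiv ℝ (picardOp Y) (w, solution hY w) ∘L ContinuousLinearMap.inr ℝ (ℝ × E) C(I, E)
  have hp : HasFDerivAt (picardOp Y) (fderiv ℝ (picardOp Y) (w, solution hY w))
      (w, solution hY w) := ((contDiff_picardOp Y).differentiable (by simp) _).hasFDerivAt
  have hD : ‖D‖ < 1 := by
    have h1 : HasFDerivAt (fun γ => picardOp Y (w, γ)) D (solution hY w) :=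
      hp.comp _ (hasFDerivAt_prodMk_right w (solution hY w))
    refine (h1.le_of_lipschitz (lipschitzWith_picardOp hY w)).trans_lt ?_
    norm_num
  have hinv : (fderiv ℝ f (w, solution hY w) ∘L
      ContinuousLinearMap.inr ℝ (ℝ × E) C(I, E)).IsInvertible := by
    refine ⟨ContinuousLinearEquiv.unitsEquiv ℝ C(I, E) (Units.oneSub D hD), ?_⟩
    have h1 : fderiv ℝ f (w, solution hY w) = ContinuousLinearMap.snd ℝ (ℝ × E) C(I, E) -
      fderiv ℝ (picardOp Y) (w, solution hY w) := (hasFDerivAt_snd.sub hp).fderiv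
    rw [h1]
    ext1 γ
    rfl
  have h0 : f (w, solution hY w) = 0 := sub_eq_zero.2 (picardOp_solution hY w).symm
  have hfa : ContDiffAt ℝ ∞ f (w, solution hY w) := hf.contDiffAt
  refine (hfa.contDiffAt_implicitFunction (by simp) hinv).congr_of_eventuallyEq ?_
  filter_upwards [hfa.eventually_apply_implicitFunction (by simp) hinv] with v hv
  exact (eq_solution hY (sub_eq_zero.1 (hv.trans h0)).symm).symm

/-- The time-one map of `γ' = Y(s, γ)` as a function of `(s, x)`. -/
def endpoint (w : ℝ × E) : E := solution hY w 1

lemma contDiff_endpoint : ContDiff ℝ ∞ (endpoint hY) :=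
  (ContinuousMap.evalCLM ℝ (1 : I) : C(I, E) →L[ℝ] E).contDiff.comp (contDiff_solution hY)

end Picard

end

/-! ### Density of exponential sums in `C^∞(ℝ^d)` -/

section

open Filter Topology MeasureTheory
open scoped Convolution

section PeakConvolution

variable {d : ℕ} {F : Type} [NormedAddCommGroup F] [NormedSpace ℝ F]

/-- A kernel on `ℝ^d` with a unique maximum at the origin, built from exponentials of linear forms;
it is positive on the closed ball of radius `ρ`. -/
def coshKernel (d : ℕ) (ρ : ℝ) (z : Config d) : ℝ :=
  d * Real.cosh ρ + 1 - ∑ i, Real.cosh (z i)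

lemma continuous_coshKernel (ρ : ℝ) : Continuous (coshKernel d ρ) := by
  unfold coshKernel
  fun_prop

lemma coshKernel_pos {ρ : ℝ} (hρ : 0 ≤ ρ) {z : Config d} (hz : ‖z‖ ≤ ρ) : 0 < coshKernel d ρ z := by
  have h : ∑ i, Real.cosh (z i) ≤ ∑ _i : Fin d, Real.cosh ρ := by
    refine Finset.sum_le_sum fun i _ => Real.cosh_le_cosh.2 ?_
    rw [abs_of_nonneg hρ]
    exact (PiLp.norm_apply_le z i).trans hz
  simp only [Finset.sum_const, Finset.card_univ, Fintype.card_fin, nsmul_eq_mul] at h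
  unfold coshKernel
  linarith

lemma coshKernel_lt (ρ : ℝ) {z : Config d} (hz : z ≠ 0) : coshKernel d ρ z < coshKernel d ρ 0 := by
  unfold coshKernel
  refine sub_lt_sub_left (Finset.sum_lt_sum (fun i _ => ?_) ?_) _
  · simp
  · obtain ⟨i, hi⟩ : ∃ i, z i ≠ 0 := by
      by_contra! h
      exact hz (by ext i; simpa using h i)
    exact ⟨i, Finset.mem_univ _, by simpa using Real.one_lt_cosh.2 hi⟩

/-- Convolution with the `n`-th power of the kernel, normalised on the ball of radius `ρ`. -/
def peakConv (ρ : ℝ) (n : ℕ) (f : Config d → F) : Config d → F :=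
  (∫ z in Metric.closedBall (0 : Config d) ρ, coshKernel d ρ z ^ n)⁻¹ •
    ((fun z => coshKernel d ρ z ^ n) ⋆[ContinuousLinearMap.lsmul ℝ ℝ, volume] f)

lemma locallyIntegrable_coshKernel_pow (ρ : ℝ) (n : ℕ) :
    LocallyIntegrable (fun z => coshKernel d ρ z ^ n) :=
  ((continuous_coshKernel ρ).pow n).locallyIntegrable

lemma fderiv_peakConv (ρ : ℝ) (n : ℕ) {f : Config d → F} (hf : ContDiff ℝ ∞ f)
    (hc : HasCompactSupport f) : fderiv ℝ (peakConv ρ n f) = peakConv ρ n (fderiv ℝ f) := by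
  ext1 x
  have := hc.hasFDerivAt_convolution_right (ContinuousLinearMap.lsmul ℝ ℝ)
    (locallyIntegrable_coshKernel_pow (d := d) ρ n) (hf.of_le (by simp)) x
  rw [peakConv, (this.const_smul _).fderiv]
  rfl

/-- The convolutions converge uniformly on a ball containing the support; this is the scalar peak
function theorem for functions with values in `C(ball, F)`. -/
lemma eventually_norm_peakConv_sub_lt [CompleteSpace F] {R : ℝ} (hR : 0 < R)
    {f : Config d → F} (hf : Continuous f)
    (hs : tsupport f ⊆ Metric.closedBall 0 R) {ε : ℝ} (hε : 0 < ε) :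
    ∀ᶠ n : ℕ in atTop, ∀ x ∈ Metric.closedBall (0 : Config d) R,
      ‖peakConv (2 * R) n f x - f x‖ < ε := by
  have : CompactSpace (Metric.closedBall (0 : Config d) R) :=
    isCompact_iff_compactSpace.1 (isCompact_closedBall _ _)
  let u : C(Config d, C(Metric.closedBall (0 : Config d) R, F)) :=
    ContinuousMap.curry
      ⟨fun p : Config d × Metric.closedBall (0 : Config d) R => f (p.2 - p.1), by fun_prop⟩
  have hint : (0 : Config d) ∈ closure (interior (Metric.closedBall (0 : Config d) (2 * R))) :=
    subset_closure (Metric.ball_subset_interior_closedBall (Metric.mem_ball_self (by positivity)))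
  have key := tendsto_setIntegral_pow_smul_of_unique_maximum_of_isCompact_of_continuousOn
    (μ := (volume : Measure (Config d))) (isCompact_closedBall (0 : Config d) (2 * R))
    (continuous_coshKernel (2 * R)).continuousOn (fun y _ hy => coshKernel_lt (2 * R) hy)
    (fun z hz => (coshKernel_pos (by positivity) (mem_closedBall_zero_iff.1 hz)).le)
    (coshKernel_pos (by positivity) (by simp; positivity)) hint u.continuous.continuousOn
  filter_upwards [Metric.tendsto_nhds.1 key ε hε] with n hn x hx
  have h2 := (ContinuousMap.dist_lt_iff hε).1 hn ⟨x, hx⟩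
  rw [dist_eq_norm] at h2
  have h0 : u 0 ⟨x, hx⟩ = f x := congrArg f (sub_zero x)
  rw [h0, ContinuousMap.smul_apply] at h2
  have h1 : ((fun z => coshKernel d (2 * R) z ^ n) ⋆[ContinuousLinearMap.lsmul ℝ ℝ, volume] f) x =
      (∫ z in Metric.closedBall (0 : Config d) (2 * R), coshKernel d (2 * R) z ^ n • u z)
        ⟨x, hx⟩ := by
    rw [convolution_def]
    have hi : IntegrableOn (fun z => coshKernel d (2 * R) z ^ n • u z)
        (Metric.closedBall (0 : Config d) (2 * R)) :=
      (((continuous_coshKernel (2 * R)).pow n).smul u.continuous).continuousOn.integrableOn_compact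
        (isCompact_closedBall _ _)
    have h3 := (ContinuousMap.evalCLM ℝ (⟨x, hx⟩ : Metric.closedBall (0 : Config d) R) :
      C(Metric.closedBall (0 : Config d) R, F) →L[ℝ] F).integral_comp_comm hi
    refine Eq.trans ?_ h3
    symm
    refine setIntegral_eq_integral_of_forall_compl_eq_zero fun z hz => ?_
    have : x - z ∉ tsupport f := fun h => hz <| by
      have h4 := mem_closedBall_zero_iff.1 (hs h)
      rw [mem_closedBall_zero_iff] at hx ⊢
      calc ‖z‖ = ‖x - (x - z)‖ := by rw [sub_sub_cancel]
        _ ≤ ‖x‖ + ‖x - z‖ := norm_sub_le _ _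
        _ ≤ 2 * R := by linarith
    change coshKernel d (2 * R) z ^ n • f (x - z) = 0
    rw [image_eq_zero_of_notMem_tsupport this, smul_zero]
  rw [peakConv, Pi.smul_apply, h1]
  exact h2

lemma eventually_norm_iteratedFDeriv_peakConv_sub_lt [CompleteSpace F] {R : ℝ} (hR : 0 < R) (k : ℕ)
    {f : Config d → F} (hf : ContDiff ℝ ∞ f) (hs : tsupport f ⊆ Metric.closedBall 0 R) {ε : ℝ}
    (hε : 0 < ε) :
    ∀ᶠ n : ℕ in atTop, ∀ x ∈ Metric.closedBall (0 : Config d) R,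
      ‖iteratedFDeriv ℝ k (peakConv (2 * R) n f) x - iteratedFDeriv ℝ k f x‖ < ε := by
  induction k generalizing F with
  | zero =>
    filter_upwards [eventually_norm_peakConv_sub_lt hR hf.continuous hs hε] with n hn x hx
    simp only [iteratedFDeriv_zero_eq_comp, Function.comp_apply]
    rw [← map_sub, LinearIsometryEquiv.norm_map]
    exact hn x hx
  | succ k ih =>
    have hc : HasCompactSupport f := (isCompact_closedBall _ _).of_isClosed_subset
      (isClosed_tsupport f) hs
    filter_upwards [ih (hf.fderiv_right (by simp)) ((tsupport_fderiv_subset ℝ).trans hs)]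
      with n hn x hx
    simp only [iteratedFDeriv_succ_eq_comp_right, Function.comp_apply]
    rw [← dist_eq_norm, LinearIsometryEquiv.dist_map, dist_eq_norm]
    simp only [fderiv_peakConv _ n hf hc]
    exact hn x hx

end PeakConvolution

section ExponentialDensity

variable {d : ℕ}

/-- The space of linear combinations of the exponentials of linear forms. -/
def expSpan (d : ℕ) : Submodule ℝ (Config d → ℝ) :=
  Submodule.span ℝ (Set.range fun (a : Config d) (x : Config d) => Real.exp (inner ℝ a x))

lemma exp_inner_mem_expSpan (a : Config d) :
    (fun x => Real.exp (inner ℝ a x)) ∈ expSpan d :=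
  Submodule.subset_span ⟨a, rfl⟩

lemma one_mem_expSpan : (1 : Config d → ℝ) ∈ expSpan d := by
  convert exp_inner_mem_expSpan (0 : Config d) using 1
  ext x
  simp

lemma mul_mem_expSpan {f g : Config d → ℝ} (hf : f ∈ expSpan d) (hg : g ∈ expSpan d) :
    f * g ∈ expSpan d := by
  have h := Submodule.mul_mem_mul hf hg
  rw [expSpan, Submodule.span_mul_span] at h
  refine Submodule.span_mono ?_ h
  rintro _ ⟨_, ⟨a, rfl⟩, _, ⟨b, rfl⟩, rfl⟩
  exact ⟨a + b, by ext x; simp [inner_add_left, Real.exp_add]⟩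

lemma coshKernel_pow_mem_expSpan (ρ : ℝ) (n : ℕ) :
    (fun z => coshKernel d ρ z ^ n) ∈ expSpan d := by
  have h1 : coshKernel d ρ ∈ expSpan d := by
    have : coshKernel d ρ = (d * Real.cosh ρ + 1) • (1 : Config d → ℝ) -
        ∑ i, (1 / 2 : ℝ) • ((fun x => Real.exp (inner ℝ (EuclideanSpace.single i (1 : ℝ)) x)) +
          fun x => Real.exp (inner ℝ (-EuclideanSpace.single i (1 : ℝ)) x)) := by
      ext z
      simp [coshKernel, Real.cosh_eq, EuclideanSpace.inner_single_left, div_eq_inv_mul, mul_add]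
    rw [this]
    exact Submodule.sub_mem _ (Submodule.smul_mem _ _ one_mem_expSpan)
      (Submodule.sum_mem _ fun i _ => Submodule.smul_mem _ _
        (Submodule.add_mem _ (exp_inner_mem_expSpan _) (exp_inner_mem_expSpan _)))
  induction n with
  | zero =>
    simp only [pow_zero]
    exact one_mem_expSpan
  | succ n ih =>
    simp only [pow_succ]
    exact mul_mem_expSpan ih h1

variable {S : Set (SmoothMap (Config d) ℝ)}
  (hadd : ∀ f ∈ S, ∀ g ∈ S, f.add g ∈ S)
  (hexp : ∀ (c : ℝ) (a : Config d), ∃ g ∈ S, ∀ x, g x = c * Real.exp (inner ℝ a x))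
include hadd hexp

/-- Convolution with an exponential sum is an exponential sum, whose coefficients are integrals. -/
lemma exists_eq_convolution_of_mem_expSpan {k : Config d → ℝ} (hk : k ∈ expSpan d)
    {f : Config d → ℝ} (hf : Continuous f) (hc : HasCompactSupport f) :
    ∃ g ∈ S, ∀ x, g x = ∫ y, k (x - y) * f y := by
  have hcont : ∀ k ∈ expSpan d, Continuous k := by
    intro k hk
    induction hk using Submodule.span_induction with
    | mem k hk => obtain ⟨a, rfl⟩ := hk; fun_prop
    | zero => exact continuous_zero
    | add k l _ _ hk hl => exact hk.add hl
    | smul c k _ hk => exact hk.const_smul c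
  induction hk using Submodule.span_induction generalizing f with
  | mem k hk =>
    obtain ⟨a, rfl⟩ := hk
    obtain ⟨g, hg, hgx⟩ := hexp (∫ y, Real.exp (-inner ℝ a y) * f y) a
    refine ⟨g, hg, fun x => ?_⟩
    rw [hgx, ← integral_mul_const]
    congr 1 with y
    beta_reduce
    rw [inner_sub_right, sub_eq_add_neg, Real.exp_add]
    ring
  | zero =>
    obtain ⟨g, hg, hgx⟩ := hexp 0 0
    exact ⟨g, hg, fun x => by simp [hgx]⟩
  | add k l hk hl ihk ihl =>
    obtain ⟨g, hg, hgx⟩ := ihk hf hc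
    obtain ⟨h, hh, hhx⟩ := ihl hf hc
    refine ⟨g.add h, hadd g hg h hh, fun x => ?_⟩
    rw [SmoothMap.add_apply, hgx, hhx, ← integral_add]
    · congr 1 with y
      simp [add_mul]
    · exact (((hcont k hk).comp (continuous_const.sub continuous_id)).mul
        hf).integrable_of_hasCompactSupport hc.mul_left
    · exact (((hcont l hl).comp (continuous_const.sub continuous_id)).mul
        hf).integrable_of_hasCompactSupport hc.mul_left
  | smul c k _ ih =>
    obtain ⟨g, hg, hgx⟩ := ih (hf.const_smul c) (hc.smul_left (f := fun _ => c))
    refine ⟨g, hg, fun x => ?_⟩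
    rw [hgx]
    congr 1 with y
    simp only [Pi.smul_apply, smul_eq_mul]
    ring

/-- Linear combinations of exponentials of linear forms are dense in `C^∞(ℝ^d)`. -/
theorem eq_univ_of_exp_mem (hS : IsClosed S) : S = Set.univ := by
  refine Set.eq_univ_of_forall fun f => hS.closure_subset (SmoothMap.mem_closure_of_approx ?_)
  intro K hK m ε hε
  obtain ⟨R, hR0, hR⟩ := hK.isBounded.subset_ball_lt 0 0
  let χ : ContDiffBump (0 : Config d) := ⟨R, R + 1, hR0, by linarith⟩
  let φ : Config d → ℝ := fun x => χ x * f x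
  have hφ : ContDiff ℝ ∞ φ := χ.contDiff.mul f.contDiff
  have hs : tsupport φ ⊆ Metric.closedBall 0 (R + 1) :=
    (tsupport_mul_subset_left).trans χ.tsupport_eq.subset
  have hc : HasCompactSupport φ := (isCompact_closedBall _ _).of_isClosed_subset
    (isClosed_tsupport φ) hs
  obtain ⟨n, hn⟩ := ((Filter.eventually_all_finite (Set.finite_Iic m)).2 fun k _ =>
    eventually_norm_iteratedFDeriv_peakConv_sub_lt (by linarith) k hφ hs hε).exists
  obtain ⟨g, hg, hgx⟩ := exists_eq_convolution_of_mem_expSpan hadd hexp (Submodule.smul_mem _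
    (∫ z in Metric.closedBall (0 : Config d) (2 * (R + 1)), coshKernel d (2 * (R + 1)) z ^ n)⁻¹
    (coshKernel_pow_mem_expSpan (2 * (R + 1)) n)) hφ.continuous hc
  have hgφ : g.toFun = peakConv (2 * (R + 1)) n φ := by
    ext x
    rw [hgx, peakConv, Pi.smul_apply, convolution_eq_swap, ← integral_smul]
    simp [mul_assoc]
  refine ⟨g, hg, fun k hk x hx => ?_⟩
  have heq : φ =ᶠ[𝓝 x] f := by
    filter_upwards [Metric.isOpen_ball.mem_nhds (hR hx)] with y hy
    simp only [φ, χ.one_of_mem_closedBall (Metric.ball_subset_closedBall hy), one_mul]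
  rw [hgφ, ← (heq.iteratedFDeriv ℝ k).eq_of_nhds]
  exact hn k hk x (Metric.closedBall_subset_closedBall (by linarith)
    (Metric.ball_subset_closedBall (hR hx)))

end ExponentialDensity

end

/-! ### Reachable maps and constant controls -/

section

open Filter Topology MeasureTheory unitInterval

section Reachability

variable {d m : ℕ} {H : (Fin m → ℝ) → Phase d → ℝ}

lemma IsPiecewiseConstant.concat {τ₁ τ₂ : ℝ} {u₁ u₂ : ℝ → Fin m → ℝ}
    (h₁ : IsPiecewiseConstant τ₁ u₁) (h₂ : IsPiecewiseConstant τ₂ u₂) :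
    IsPiecewiseConstant (τ₁ + τ₂) fun t => if t < τ₁ then u₁ t else u₂ (t - τ₁) := by
  obtain ⟨S₁, hS₁⟩ := h₁
  obtain ⟨S₂, hS₂⟩ := h₂
  refine ⟨insert τ₁ (S₁ ∪ S₂.image (· + τ₁)), fun s t hs hst ht hr => ?_⟩
  have hτ : τ₁ < s ∨ t < τ₁ := by
    have := hr τ₁ (by simp)
    rw [Set.mem_Icc, not_and_or, not_le, not_le] at this
    exact this
  rcases hτ with h | h
  · simp only [if_neg (not_lt.2 h.le), if_neg (not_lt.2 (h.le.trans hst))]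
    refine hS₂ _ _ (by linarith) (by linarith) (by linarith) fun r hr' hmem => ?_
    exact hr (r + τ₁) (by simp [hr']) ⟨by linarith [hmem.1], by linarith [hmem.2]⟩
  · simp only [if_pos h, if_pos (hst.trans_lt h)]
    exact hS₁ s t hs hst h.le fun r hr' => hr r (by simp [hr'])

lemma IsTrajectory.congr {τ : ℝ} {u v : ℝ → Fin m → ℝ} {γ δ : ℝ → Phase d}
    (h : IsTrajectory H τ u γ) (hγ : ∀ t ∈ Set.Icc 0 τ, δ t = γ t)
    (hu : ∀ t ∈ Set.Ioo 0 τ, v t = u t) :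
    IsTrajectory H τ v δ := by
  obtain ⟨hc, S, hS⟩ := h
  refine ⟨hc.congr hγ, S, fun t ht htS => ?_⟩
  rw [hu t ht, hγ t (Set.Ioo_subset_Icc_self ht)]
  refine (hS t ht htS).congr_of_eventuallyEq ?_
  filter_upwards [isOpen_Ioo.mem_nhds ht] with s hs using hγ s (Set.Ioo_subset_Icc_self hs)

lemma IsTrajectory.shift {τ₁ τ₂ : ℝ} (h₁ : 0 ≤ τ₁) {u : ℝ → Fin m → ℝ} {γ : ℝ → Phase d}
    (h : IsTrajectory H (τ₁ + τ₂) u γ) :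
    IsTrajectory H τ₂ (fun t => u (t + τ₁)) fun t => γ (t + τ₁) := by
  obtain ⟨hc, S, hS⟩ := h
  refine ⟨hc.comp (by fun_prop) fun t ht => ⟨by linarith [ht.1], by linarith [ht.2]⟩,
    S.image (· - τ₁), fun t ht htS => ?_⟩
  refine HasDerivAt.comp_add_const t τ₁
    (hS (t + τ₁) ⟨by linarith [ht.1], by linarith [ht.2]⟩ fun hmem => htS ?_)
  exact Finset.mem_image.2 ⟨_, hmem, by ring⟩

lemma IsTrajectory.restrict {τ₁ τ₂ : ℝ} (h₂ : 0 ≤ τ₂) {u : ℝ → Fin m → ℝ} {γ : ℝ → Phase d}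
    (h : IsTrajectory H (τ₁ + τ₂) u γ) : IsTrajectory H τ₁ u γ := by
  obtain ⟨hc, S, hS⟩ := h
  exact ⟨hc.mono (Set.Icc_subset_Icc_right (by linarith)), S,
    fun t ht => hS t ⟨ht.1, by linarith [ht.2]⟩⟩

lemma IsTrajectory.glue {τ₁ τ₂ : ℝ} {u : ℝ → Fin m → ℝ} {γ : ℝ → Phase d} (h₁ : 0 ≤ τ₁)
    (h₂ : 0 ≤ τ₂) (hγ₁ : IsTrajectory H τ₁ u γ)
    (hγ₂ : IsTrajectory H τ₂ (fun t => u (t + τ₁)) fun t => γ (t + τ₁)) :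
    IsTrajectory H (τ₁ + τ₂) u γ := by
  obtain ⟨hc₁, S₁, hS₁⟩ := hγ₁
  obtain ⟨hc₂, S₂, hS₂⟩ := hγ₂
  refine ⟨?_, insert τ₁ (S₁ ∪ S₂.image (· + τ₁)), fun t ht htS => ?_⟩
  · have hc₂' : ContinuousOn γ (Set.Icc τ₁ (τ₁ + τ₂)) := by
      have := hc₂.comp (f := fun t => t - τ₁) (s := Set.Icc τ₁ (τ₁ + τ₂)) (by fun_prop)
        fun t ht => ⟨by linarith [ht.1], by linarith [ht.2]⟩
      exact this.congr fun t _ => by simp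
    have := hc₁.union_of_isClosed hc₂' isClosed_Icc isClosed_Icc
    rwa [Set.Icc_union_Icc_eq_Icc h₁ (by linarith)] at this
  · simp only [Finset.mem_insert, Finset.mem_union, Finset.mem_image, not_or] at htS
    obtain ⟨hne, hS₁', hS₂'⟩ := htS
    rcases lt_or_gt_of_ne hne with hlt | hgt
    · exact hS₁ t ⟨ht.1, hlt⟩ hS₁'
    · have := hS₂ (t - τ₁) ⟨by linarith, by linarith [ht.2]⟩ fun hmem => hS₂' ⟨_, hmem, by ring⟩
      have := this.comp_sub_const t τ₁
      simpa using this

lemma IsFlowMap.concat {τ₁ τ₂ : ℝ} (h₁ : 0 ≤ τ₁) (h₂ : 0 ≤ τ₂) {u₁ u₂ : ℝ → Fin m → ℝ}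
    {Φ₁ Φ₂ : Phase d → Phase d} (hΦ₁ : IsFlowMap H τ₁ u₁ Φ₁) (hΦ₂ : IsFlowMap H τ₂ u₂ Φ₂) :
    IsFlowMap H (τ₁ + τ₂) (fun t => if t < τ₁ then u₁ t else u₂ (t - τ₁)) (Φ₂ ∘ Φ₁) := by
  intro x y
  constructor
  · intro h
    obtain ⟨γ₁, hγ₁, h10, h11⟩ := (hΦ₁ x _).1 rfl
    obtain ⟨γ₂, hγ₂, h20, h21⟩ := (hΦ₂ (Φ₁ x) y).1 h
    let γ : ℝ → Phase d := fun t => if t ≤ τ₁ then γ₁ t else γ₂ (t - τ₁)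
    have e₁ : ∀ t, t ≤ τ₁ → γ t = γ₁ t := fun t ht => if_pos ht
    have e₂ : ∀ t, 0 ≤ t → γ (t + τ₁) = γ₂ t := by
      intro t ht
      rcases ht.eq_or_lt with rfl | ht
      · rw [zero_add, e₁ _ le_rfl, h11, h20]
      · simp [γ, not_le.2 ht]
    refine ⟨γ, IsTrajectory.glue h₁ h₂ (hγ₁.congr (fun t ht => e₁ t ht.2) fun t ht => if_pos ht.2)
      (hγ₂.congr (fun t ht => e₂ t ht.1) fun t ht => ?_), ?_, ?_⟩
    · simp [not_lt.2 ht.1.le]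
    · rw [e₁ 0 h₁, h10]
    · rw [add_comm, e₂ _ h₂, h21]
  · rintro ⟨γ, hγ, h0, h1⟩
    have a := (hΦ₁ x (γ τ₁)).2 ⟨γ, (hγ.restrict h₂).congr (fun _ _ => rfl)
      fun t ht => (if_pos ht.2).symm, h0, rfl⟩
    rw [Function.comp_apply, a]
    refine (hΦ₂ _ y).2 ⟨fun t => γ (t + τ₁), (hγ.shift h₁).congr (fun _ _ => rfl) fun t ht => ?_,
      by simp, (congrArg γ (add_comm _ _)).trans h1⟩
    simp [not_lt.2 ht.1.le]

/-- Pairs `(τ, Φ)` such that the smooth map `Φ` is the flow map at time `τ` of some piecewise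
constant control. -/
def reachable (H : (Fin m → ℝ) → Phase d → ℝ) : Set (ℝ × SmoothMap (Phase d) (Phase d)) :=
  {p | 0 ≤ p.1 ∧ ∃ u, IsPiecewiseConstant p.1 u ∧ IsFlowMap H p.1 u p.2}

lemma add_comp_mem_reachable {p q : ℝ × SmoothMap (Phase d) (Phase d)} (hp : p ∈ reachable H)
    (hq : q ∈ reachable H) : (p.1 + q.1, q.2.comp p.2) ∈ reachable H := by
  obtain ⟨hp0, u, hu, hup⟩ := hp
  obtain ⟨hq0, v, hv, hvq⟩ := hq
  exact ⟨add_nonneg hp0 hq0, _, hu.concat hv, hup.concat hp0 hq0 hvq⟩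

/-- Concatenation of controls passes to limits, composition being continuous for the `C^∞_loc`
topology. -/
lemma add_comp_mem_closure_reachable {s t : ℝ} {Φ Ψ : SmoothMap (Phase d) (Phase d)}
    (hΦ : (s, Φ) ∈ closure (reachable H)) (hΨ : (t, Ψ) ∈ closure (reachable H)) :
    (s + t, Ψ.comp Φ) ∈ closure (reachable H) := by
  refine map_mem_closure₂ (f := fun p q : ℝ × SmoothMap (Phase d) (Phase d) =>
    (p.1 + q.1, q.2.comp p.2)) ?_ hΦ hΨ fun p hp q hq => add_comp_mem_reachable hp hq
  exact ((continuous_fst.comp continuous_fst).add (continuous_fst.comp continuous_snd)).prodMk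
    (SmoothMap.continuous_comp.comp
      ((continuous_snd.comp continuous_snd).prodMk (continuous_snd.comp continuous_fst)))

lemma comp_mem_closure_reachable_zero {Φ Ψ : SmoothMap (Phase d) (Phase d)}
    (hΦ : (0, Φ) ∈ closure (reachable H)) (hΨ : (0, Ψ) ∈ closure (reachable H)) :
    (0, Ψ.comp Φ) ∈ closure (reachable H) := by
  simpa using add_comp_mem_closure_reachable hΦ hΨ

/-- The sets `{Φ | ‖Φ - Ψ‖_{C^l(K)} < ε}` are neighbourhoods of `Ψ`, so a pair in the closure with
time `0` yields small-time approximations. -/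
lemma exists_isCloseOn_of_mem_closure {Ψ : SmoothMap (Phase d) (Phase d)}
    (h : (0, Ψ) ∈ closure (reachable H)) {ε : ℝ} (hε : 0 < ε) {K : Set (Phase d)}
    (hK : IsCompact K) (l : ℕ) :
    ∃ τ ∈ Set.Icc 0 ε, ∃ (u : ℝ → Fin m → ℝ) (Φ : Phase d → Phase d),
      IsPiecewiseConstant τ u ∧ IsFlowMap H τ u Φ ∧ IsCloseOn l K ε Φ Ψ := by
  have hU := prod_mem_nhds (Iio_mem_nhds hε) (SmoothMap.isClose_mem_nhds Ψ hK l hε)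
  obtain ⟨⟨τ, Φ⟩, ⟨hτ, hΦ⟩, h0, u, hu, huΦ⟩ := mem_closure_iff_nhds.1 h _ hU
  refine ⟨τ, ⟨h0, le_of_lt hτ⟩, u, Φ, hu, huΦ, Φ.contDiff, Ψ.contDiff, fun k hk x hx => ?_⟩
  have hle : (k : WithTop ℕ∞) ≤ ∞ := by exact_mod_cast le_top
  have := iteratedFDeriv_sub_apply (x := x) (Φ.contDiff.of_le hle).contDiffAt
    (Ψ.contDiff.of_le hle).contDiffAt
  change ‖iteratedFDeriv ℝ k (Φ.toFun - Ψ.toFun) x‖ < ε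
  rw [this]
  exact hΦ k hk x hx

variable {Y : SmoothMap (ℝ × Phase d) (Phase d)}
  (hY : ∀ s, LipschitzWith (1 / 2) fun x => Y (s, x))

/-- Constant controls: rescaling time by `τ` and translating phase space by `b` turns the Hamilton
equation into an equation on `[0, 1]` whose solutions are fixed points of the Picard operator. -/
lemma isFlowMap_const {τ s : ℝ} (hτ : 0 < τ) {w : Fin m → ℝ} {b : Phase d}
    (h : ∀ x, Y (s, x) = τ • hamVectorField (H w) (x + b)) :
    IsFlowMap H τ (fun _ => w) fun x => endpoint hY (s, x - b) + b := by
  intro x y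
  constructor
  · rintro rfl
    set ζ := solution hY (s, x - b) with hζ
    let η : ℝ → Phase d := fun r => x - b + ∫ ρ in (0 : ℝ)..r, Y (s, unitExtend ζ ρ)
    have hcont : Continuous fun ρ => Y (s, unitExtend ζ ρ) :=
      Y.contDiff.continuous.comp (continuous_const.prodMk (continuous_unitExtend ζ))
    have hηζ : ∀ r : I, η r = ζ r := fun r => by
      conv_rhs => rw [hζ, ← picardOp_solution hY (s, x - b)]
      rw [picardOp_apply]
    have hη : ∀ r, HasDerivAt η (Y (s, unitExtend ζ r)) r := fun r =>
      (hcont.integral_hasStrictDerivAt 0 r).hasDerivAt.const_add _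
    have hγ : ∀ t, HasDerivAt (fun t => η (τ⁻¹ * t) + b)
        (τ⁻¹ • Y (s, unitExtend ζ (τ⁻¹ * t))) t := fun t => by
      have := (hη (τ⁻¹ * t)).scomp t ((hasDerivAt_id t).const_mul τ⁻¹)
      simpa using this.add_const b
    refine ⟨fun t => η (τ⁻¹ * t) + b, ⟨fun t _ => (hγ t).continuousAt.continuousWithinAt, ∅,
      fun t ht _ => ?_⟩, by simp [η], ?_⟩
    · convert hγ t using 1
      have hmem : τ⁻¹ * t ∈ I :=
        ⟨by have := ht.1; positivity, by rw [inv_mul_le_iff₀ hτ]; linarith [ht.2]⟩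
      rw [unitExtend, Set.IccExtend_of_mem _ _ hmem, h, smul_smul, inv_mul_cancel₀ hτ.ne', one_smul,
        ← hηζ ⟨_, hmem⟩]
    · have := hηζ 1
      simp only [Set.Icc.coe_one] at this
      simp only [inv_mul_cancel₀ hτ.ne', this]
      rfl
  · rintro ⟨γ, ⟨hc, S, hS⟩, rfl, rfl⟩
    have hmaps : ∀ r : I, τ * r ∈ Set.Icc 0 τ := fun r =>
      ⟨mul_nonneg hτ.le r.2.1, mul_le_of_le_one_right hτ.le r.2.2⟩
    let δ : C(I, Phase d) := ⟨fun r => γ (τ * r) - b,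
      (hc.comp_continuous (by fun_prop) hmaps).sub continuous_const⟩
    have hδ : δ = solution hY (s, γ 0 - b) := by
      refine eq_solution hY ?_
      ext1 t
      rw [picardOp_apply]
      have key := integral_eq_of_hasDerivAt_off_countable_of_le (a := 0) (b := t)
        (fun r => γ (τ * r)) (fun r => Y (s, unitExtend δ r)) t.2.1
        (s := (fun r => τ * r) ⁻¹' S) ?_ ?_ ?_ ?_
      · simp only [key, mul_zero]
        change γ 0 - b + (γ (τ * t) - γ 0) = γ (τ * t) - b
        abel
      · exact (S.finite_toSet.preimage (mul_right_injective₀ hτ.ne').injOn).countable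
      · exact hc.comp (by fun_prop) fun r hr => hmaps ⟨r, hr.1, hr.2.trans t.2.2⟩
      · rintro r ⟨⟨hr0, hr1⟩, hrS⟩
        have hrt : r < 1 := hr1.trans_le t.2.2
        have h1 := (hS (τ * r) ⟨by positivity, by nlinarith⟩ hrS).scomp r
          ((hasDerivAt_id r).const_mul τ)
        have h2 : unitExtend δ r = γ (τ * r) - b :=
          Set.IccExtend_of_mem zero_le_one δ ⟨hr0.le, hrt.le⟩
        rw [mul_one] at h1
        rw [h2, h, sub_add_cancel]
        exact h1
      · exact (Y.contDiff.continuous.comp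
          (continuous_const.prodMk (continuous_unitExtend δ))).intervalIntegrable _ _
    have h1 : endpoint hY (s, γ 0 - b) = γ τ - b := by
      rw [endpoint, ← hδ]
      simp [δ]
    simp only [h1, sub_add_cancel]

end Reachability

end

section

open Filter Topology

/-! ### Vertical shears -/

section Shears

variable {d : ℕ}

/-- The Riesz isomorphism from linear forms to vectors, as a continuous linear map. -/
def rieszCLM (d : ℕ) : (Config d →L[ℝ] ℝ) →L[ℝ] Config d :=
  LinearMap.mkContinuous
    { toFun := (InnerProductSpace.toDual ℝ (Config d)).symm
      map_add' := fun _ _ => map_add _ _ _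
      map_smul' := fun c L => by simp } 1 (fun L => by simp)

/-- The gradient of a smooth function, as a smooth map. -/
def grad (f : SmoothMap (Config d) ℝ) : SmoothMap (Config d) (Config d) :=
  (SmoothMap.ofCLM (rieszCLM d)).comp f.deriv

lemma grad_apply (f : SmoothMap (Config d) ℝ) (q : Config d) : grad f q = gradient f q := rfl

lemma grad_eq_of_hasFDerivAt {f : SmoothMap (Config d) ℝ} {q v : Config d}
    (h : HasFDerivAt f (innerSL ℝ v) q) : grad f q = v := by
  rw [grad_apply]
  exact HasGradientAt.gradient (hasGradientAt_iff_hasFDerivAt.2 h)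

lemma hasFDerivAt_grad (f : SmoothMap (Config d) ℝ) (q : Config d) :
    HasFDerivAt f (innerSL ℝ (grad f q)) q :=
  hasGradientAt_iff_hasFDerivAt.1
    (f.contDiff.differentiable (by simp) q).hasGradientAt

lemma grad_add (f g : SmoothMap (Config d) ℝ) (q : Config d) :
    grad (f.add g) q = grad f q + grad g q := by
  refine grad_eq_of_hasFDerivAt ?_
  rw [map_add]
  exact (hasFDerivAt_grad f q).add (hasFDerivAt_grad g q)

/-- The vertical shear `(q, p) ↦ (q, p - ∇f(q))`. -/
def shear (f : SmoothMap (Config d) ℝ) : SmoothMap (Phase d) (Phase d) :=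
  (SmoothMap.ofCLM (ContinuousLinearMap.id ℝ (Phase d))).add
    ((SmoothMap.ofCLM (-ContinuousLinearMap.inr ℝ (Config d) (Config d))).comp
      ((grad f).comp (SmoothMap.ofCLM (ContinuousLinearMap.fst ℝ (Config d) (Config d)))))

@[simp] lemma shear_apply (f : SmoothMap (Config d) ℝ) (x : Phase d) :
    shear f x = (x.1, x.2 - grad f x.1) := by
  simp [shear, sub_eq_add_neg, Prod.ext_iff]

lemma continuous_shear : Continuous (shear : SmoothMap (Config d) ℝ → _) := by
  have h1 : Continuous (grad : SmoothMap (Config d) ℝ → _) :=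
    SmoothMap.continuous_comp.comp (continuous_const.prodMk SmoothMap.continuous_deriv)
  exact SmoothMap.continuous_add.comp (continuous_const.prodMk (SmoothMap.continuous_comp.comp
    (continuous_const.prodMk (SmoothMap.continuous_comp.comp (h1.prodMk continuous_const)))))

lemma shear_add (f g : SmoothMap (Config d) ℝ) : shear (f.add g) = (shear g).comp (shear f) := by
  ext1 x
  simp [grad_add, sub_sub]

/-- The shear of `f` is the time-one map of the Hamiltonian `(q, p) ↦ f q`, whose flow is
`t ↦ shear (t f)`. -/
lemma isHamiltonianDiffeo_shear (f : SmoothMap (Config d) ℝ) : IsHamiltonianDiffeo (shear f) := by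
  have hg : ContDiff ℝ ∞ fun z : ℝ × Phase d => z.1 • grad f z.2.1 :=
    contDiff_fst.smul ((grad f).contDiff.comp (contDiff_fst.comp contDiff_snd))
  refine ⟨fun _ x => f x.1, fun t => ⟨fun x => (x.1, x.2 - t • grad f x.1),
    fun x => (x.1, x.2 + t • grad f x.1), fun x => by simp, fun x => by simp⟩,
    f.contDiff.comp (contDiff_fst.comp contDiff_snd),
    (contDiff_fst.comp contDiff_snd).prodMk ((contDiff_snd.comp contDiff_snd).sub hg),
    (contDiff_fst.comp contDiff_snd).prodMk ((contDiff_snd.comp contDiff_snd).add hg),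
    fun x => by simp, fun t x => ?_, fun x => by simp⟩
  have h1 : hamVectorField (fun x : Phase d => f x.1) (x.1, x.2 - t • grad f x.1) =
      (0, -grad f x.1) := by
    simp only [hamVectorField, grad_apply, Prod.mk.injEq, and_true]
    exact gradient_const _ _
  change HasDerivAt (fun s : ℝ => ((x.1, x.2 - s • grad f x.1) : Phase d))
    (hamVectorField (fun x : Phase d => f x.1) (x.1, x.2 - t • grad f x.1)) t
  rw [h1]
  refine (hasDerivAt_const t x.1).prodMk ?_
  simpa using ((hasDerivAt_id t).smul_const (grad f x.1)).const_sub x.2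

end Shears

/-! ### The control potentials -/

section Potentials

variable {d : ℕ}

/-- The Gaussian `q ↦ e^{-|q|²/2}`. -/
def gaussian (d : ℕ) : SmoothMap (Config d) ℝ :=
  ⟨fun q => Real.exp (-‖q‖ ^ 2 / 2), ((contDiff_norm_sq ℝ).neg.div_const 2).exp⟩

/-- The potential `∑ u_j q_j + u_{d+1} e^{-|q|²/2}` switched on by the control value `u`. -/
def controlPotential (u : Fin (d + 1) → ℝ) : SmoothMap (Config d) ℝ :=
  ⟨fun q => ∑ j : Fin d, u j.castSucc * q j + u (Fin.last d) * gaussian d q,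
    (ContDiff.sum fun j _ => by fun_prop).add (contDiff_const.mul (gaussian d).contDiff)⟩

/-- The linear part of a control value, as a vector. -/
def linearPart (u : Fin (d + 1) → ℝ) : Config d := WithLp.toLp 2 fun j => u j.castSucc

lemma controlPotential_apply (u : Fin (d + 1) → ℝ) (q : Config d) :
    controlPotential u q = inner ℝ (linearPart u) q + u (Fin.last d) * gaussian d q := by
  simp [controlPotential, linearPart, PiLp.inner_apply, mul_comm]

lemma controlPotential_add (u v : Fin (d + 1) → ℝ) :
    controlPotential (u + v) = (controlPotential u).add (controlPotential v) := by
  ext q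
  simp [controlPotential, add_mul, Finset.sum_add_distrib]
  ring

lemma hasFDerivAt_gaussian (q : Config d) :
    HasFDerivAt (gaussian d) (innerSL ℝ (-gaussian d q • q)) q := by
  have h1 : HasFDerivAt (fun q : Config d => -‖q‖ ^ 2 / 2) (-innerSL ℝ q) q := by
    have := ((hasStrictFDerivAt_norm_sq q).hasFDerivAt.neg).mul_const (2⁻¹ : ℝ)
    refine this.congr_fderiv ?_
    ext v
    simp
  refine h1.exp.congr_fderiv ?_
  ext v
  simp [gaussian]

lemma grad_controlPotential (u : Fin (d + 1) → ℝ) (q : Config d) :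
    grad (controlPotential u) q = linearPart u - (u (Fin.last d) * gaussian d q) • q := by
  refine grad_eq_of_hasFDerivAt ?_
  have h : (controlPotential u).toFun =
      fun q => innerSL ℝ (linearPart u) q + u (Fin.last d) * gaussian d q := by
    ext q
    exact controlPotential_apply u q
  rw [h]
  refine ((innerSL ℝ (linearPart u)).hasFDerivAt.add
    ((hasFDerivAt_gaussian q).const_mul (u (Fin.last d)))).congr_fderiv ?_
  ext v
  simp [sub_eq_add_neg, mul_assoc]

lemma grad_controlPotential_smul (c : ℝ) (u : Fin (d + 1) → ℝ) (q : Config d) :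
    grad (controlPotential (c • u)) q = c • grad (controlPotential u) q := by
  have : linearPart (c • u) = c • linearPart u := rfl
  simp [grad_controlPotential, this, smul_sub, smul_smul, mul_assoc]

/-- The gradient of the Gaussian is Lipschitz: its derivative is bounded by
`(1 + |q|²) e^{-|q|²/2} ≤ 3`. -/
lemma lipschitzWith_gaussian_smul : LipschitzWith 3 fun q : Config d => gaussian d q • q := by
  have hd : ∀ q : Config d, HasFDerivAt (fun q : Config d => gaussian d q • q)
      (gaussian d q • ContinuousLinearMap.id ℝ (Config d) +
        (innerSL ℝ (-gaussian d q • q)).smulRight q) q := fun q =>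
    (hasFDerivAt_gaussian q).smul (hasFDerivAt_id q)
  refine lipschitzWith_of_nnnorm_fderiv_le (fun q => (hd q).differentiableAt) fun q => ?_
  rw [(hd q).fderiv, ← NNReal.coe_le_coe, coe_nnnorm]
  have hpos : 0 ≤ gaussian d q := (Real.exp_pos _).le
  have h1 : gaussian d q ≤ 1 := Real.exp_le_one_iff.2 (by have := sq_nonneg ‖q‖; linarith)
  have h2 : gaussian d q * ‖q‖ ^ 2 ≤ 2 := by
    have h3 : ‖q‖ ^ 2 / 2 + 1 ≤ Real.exp (‖q‖ ^ 2 / 2) := Real.add_one_le_exp _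
    have h4 : gaussian d q * Real.exp (‖q‖ ^ 2 / 2) = 1 := by
      change Real.exp _ * _ = _
      rw [← Real.exp_add, ← Real.exp_zero]
      congr 1
      ring
    nlinarith
  refine (norm_add_le _ _).trans ?_
  rw [norm_smul, ContinuousLinearMap.norm_smulRight_apply, innerSL_apply_norm, norm_smul, norm_neg,
    Real.norm_of_nonneg hpos]
  have h5 := mul_le_mul_of_nonneg_left
    (ContinuousLinearMap.norm_id_le : ‖ContinuousLinearMap.id ℝ (Config d)‖ ≤ 1) hpos
  push_cast
  nlinarith

lemma exists_lipschitzWith_grad_controlPotential (u : Fin (d + 1) → ℝ) :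
    ∃ M : ℝ≥0, LipschitzWith M (grad (controlPotential u)) := by
  have h := (LipschitzWith.const (linearPart u)).sub
    ((lipschitzWith_smul (u (Fin.last d))).comp (lipschitzWith_gaussian_smul (d := d)))
  refine ⟨0 + ‖u (Fin.last d)‖₊ * 3, LipschitzWith.of_dist_le_mul fun x y => ?_⟩
  simpa [grad_controlPotential, smul_smul] using h.dist_le_mul x y

lemma hamVectorField_euclideanHamiltonian (V₀ : SmoothMap (Config d) ℝ) (u : Fin (d + 1) → ℝ)
    (x : Phase d) :
    hamVectorField (euclideanHamiltonian V₀ u) x =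
      (x.2, -(grad V₀ x.1 + grad (controlPotential u) x.1)) := by
  unfold hamVectorField
  congr 1
  · refine HasGradientAt.gradient (hasGradientAt_iff_hasFDerivAt.2 ?_)
    have h := ((hasStrictFDerivAt_norm_sq x.2).hasFDerivAt.mul_const (2⁻¹ : ℝ)).add_const
      (V₀ x.1 + controlPotential u x.1)
    have e : (fun p => euclideanHamiltonian V₀ u (x.1, p)) =
        fun p => ‖p‖ ^ 2 * 2⁻¹ + (V₀ x.1 + controlPotential u x.1) := by
      ext p
      simp [euclideanHamiltonian, controlPotential, gaussian]
      ring
    rw [e]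
    refine h.congr_fderiv ?_
    ext v
    simp
  · congr 1
    refine HasGradientAt.gradient (hasGradientAt_iff_hasFDerivAt.2 ?_)
    have h := ((hasFDerivAt_grad V₀ x.1).add
      (hasFDerivAt_grad (controlPotential u) x.1)).const_add (‖x.2‖ ^ 2 / 2)
    have e : (fun q => euclideanHamiltonian V₀ u (q, x.2)) =
        fun q => ‖x.2‖ ^ 2 / 2 + (V₀ q + controlPotential u q) := by
      ext q
      simp [euclideanHamiltonian, controlPotential, gaussian]
      ring
    rw [e]
    refine h.congr_fderiv ?_
    ext v
    simp

end Potentials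

end

section

open Filter Topology unitInterval

/-! ### Rescaled flows as smooth families -/

section Families

variable {d : ℕ}

/-- Translation of phase space. -/
def phaseTranslation (b : Phase d) : SmoothMap (Phase d) (Phase d) := ⟨fun x => x + b, by fun_prop⟩

@[simp] lemma phaseTranslation_apply (b x : Phase d) : phaseTranslation b x = x + b := rfl

/-- The rescaled vector field of the Hamiltonian `H₀ + τ⁻¹ g_u` for `τ = δ sin s`, in the momentum
variable shifted by `τ⁻¹ a`. It extends smoothly to `τ = 0`; the sine keeps `τ` bounded by `δ`, so
that the Lipschitz constant in phase space is uniform in `s`. -/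
def drivenField (V₀ : SmoothMap (Config d) ℝ) (δ : ℝ) (a : Config d) (u : Fin (d + 1) → ℝ) :
    SmoothMap (ℝ × Phase d) (Phase d) :=
  ⟨fun z => (a + (δ * Real.sin z.1) • z.2.2,
    -((δ * Real.sin z.1) • grad V₀ z.2.1 + grad (controlPotential u) z.2.1)), by
    have h1 : ContDiff ℝ ∞ fun z : ℝ × Phase d => δ * Real.sin z.1 := by fun_prop
    have h2 : ContDiff ℝ ∞ fun z : ℝ × Phase d => z.2.1 := by fun_prop
    exact (contDiff_const.add (h1.smul (by fun_prop))).prodMk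
      ((h1.smul ((grad V₀).contDiff.comp h2)).add
        ((grad (controlPotential u)).contDiff.comp h2)).neg⟩

lemma drivenField_apply (V₀ : SmoothMap (Config d) ℝ) (δ : ℝ) (a : Config d)
    (u : Fin (d + 1) → ℝ) (s : ℝ) (x : Phase d) :
    drivenField V₀ δ a u (s, x) = (a + (δ * Real.sin s) • x.2,
      -((δ * Real.sin s) • grad V₀ x.1 + grad (controlPotential u) x.1)) := rfl

lemma lipschitzWith_drivenField {V₀ : SmoothMap (Config d) ℝ} {L M δ : ℝ≥0} (a : Config d)
    {u : Fin (d + 1) → ℝ} (hL : LipschitzWith L (grad V₀))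
    (hM : LipschitzWith M (grad (controlPotential u))) (hδ : δ ≤ 1 / 2) (hδL : δ * L + M ≤ 1 / 2)
    (s : ℝ) : LipschitzWith (1 / 2) fun x => drivenField V₀ δ a u (s, x) := by
  have hρ : ‖(δ : ℝ) * Real.sin s‖₊ ≤ δ := by
    rw [← NNReal.coe_le_coe, coe_nnnorm, norm_mul, NNReal.norm_eq]
    exact mul_le_of_le_one_right δ.2 (Real.abs_sin_le_one s)
  have h1 : LipschitzWith (1 / 2) fun x : Phase d => a + ((δ : ℝ) * Real.sin s) • x.2 := by
    refine ((LipschitzWith.const a).add ((lipschitzWith_smul ((δ : ℝ) * Real.sin s)).comp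
      LipschitzWith.prod_snd)).weaken ?_
    rw [zero_add, mul_one]
    exact hρ.trans hδ
  have h2 : LipschitzWith (1 / 2) fun x : Phase d =>
      -(((δ : ℝ) * Real.sin s) • grad V₀ x.1 + grad (controlPotential u) x.1) := by
    refine ((((lipschitzWith_smul ((δ : ℝ) * Real.sin s)).comp
      (hL.comp LipschitzWith.prod_fst)).add (hM.comp LipschitzWith.prod_fst)).neg).weaken ?_
    rw [mul_one, mul_one]
    exact (add_le_add_left (mul_le_mul_left hρ L) M).trans hδL
  have h3 := h1.prodMk h2
  rw [max_self] at h3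
  exact h3

lemma drivenField_eq_smul (V₀ : SmoothMap (Config d) ℝ) (δ : ℝ) (a : Config d)
    (u : Fin (d + 1) → ℝ) {s : ℝ} (hs : 0 < δ * Real.sin s) (x : Phase d) :
    drivenField V₀ δ a u (s, x) = (δ * Real.sin s) •
      hamVectorField (euclideanHamiltonian V₀ ((δ * Real.sin s)⁻¹ • u))
        (x + (0, (δ * Real.sin s)⁻¹ • a)) := by
  rw [hamVectorField_euclideanHamiltonian, grad_controlPotential_smul, drivenField_apply]
  generalize δ * Real.sin s = τ at hs ⊢
  refine Prod.ext ?_ ?_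
  · simp [smul_smul, hs.ne', add_comm]
  · simp [smul_smul, hs.ne']

/-- If the field is constant along the line `x + t v`, with value `v`, that line is the solution. -/
lemma endpoint_eq_add {Y : SmoothMap (ℝ × Phase d) (Phase d)}
    (hY : ∀ s, LipschitzWith (1 / 2) fun x => Y (s, x)) {s : ℝ} {x v : Phase d}
    (h : ∀ t : ℝ, Y (s, x + t • v) = v) : endpoint hY (s, x) = x + v := by
  let γ : C(I, Phase d) := ⟨fun t => x + (t : ℝ) • v, by fun_prop⟩
  have hγ : picardOp Y ((s, x), γ) = γ := by
    ext1 t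
    have : ∀ r : ℝ, Y (s, unitExtend γ r) = v := fun r => h _
    rw [picardOp_apply]
    simp [this, γ]
  rw [endpoint, ← eq_solution hY hγ]
  simp [γ]

variable {V₀ : SmoothMap (Config d) ℝ} {δ : ℝ} {a : Config d} {u : Fin (d + 1) → ℝ}
  (hY : ∀ s, LipschitzWith (1 / 2) fun x => drivenField V₀ δ a u (s, x))

/-- The time-one map of the rescaled field is the flow map of the constant control `τ⁻¹ u` at the
time `τ = δ sin s`, up to conjugation with the momentum translation by `τ⁻¹ a`. -/
lemma conj_slice_mem_reachable {s : ℝ} (hs : 0 < δ * Real.sin s) :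
    (δ * Real.sin s, (phaseTranslation (0, (δ * Real.sin s)⁻¹ • a)).comp
      ((SmoothMap.slice (contDiff_endpoint hY) s).comp
        (phaseTranslation (-(0, (δ * Real.sin s)⁻¹ • a))))) ∈
      reachable (euclideanHamiltonian V₀) := by
  refine ⟨hs.le, fun _ => (δ * Real.sin s)⁻¹ • u, ⟨∅, fun _ _ _ _ _ _ => rfl⟩, ?_⟩
  have := isFlowMap_const hY hs (drivenField_eq_smul V₀ δ a u hs)
  simp only [sub_eq_add_neg] at this
  exact this

/-- Passage to the limit `s → 0+`, that is `τ → 0+`, in the family of time-one maps. -/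
lemma slice_zero_mem_closure_reachable (hδ : 0 < δ)
    (h : ∀ s, 0 < δ * Real.sin s → (δ * Real.sin s, SmoothMap.slice (contDiff_endpoint hY) s) ∈
      closure (reachable (euclideanHamiltonian V₀))) :
    (0, SmoothMap.slice (contDiff_endpoint hY) 0) ∈
      closure (reachable (euclideanHamiltonian V₀)) := by
  have hc : Continuous fun s : ℝ =>
      (δ * Real.sin s, SmoothMap.slice (contDiff_endpoint hY) s) :=
    (continuous_const.mul Real.continuous_sin).prodMk
      (SmoothMap.continuous_slice (contDiff_endpoint hY))
  have ht := (hc.tendsto 0).mono_left (nhdsWithin_le_nhds (s := Set.Ioi 0))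
  rw [Real.sin_zero, mul_zero] at ht
  refine isClosed_closure.mem_of_tendsto ht ?_
  filter_upwards [Ioo_mem_nhdsGT Real.pi_pos] with s hs
  exact h s (mul_pos hδ (Real.sin_pos_of_pos_of_lt_pi hs.1 hs.2))

end Families

/-! ### Maps reachable in time zero -/

section Generators

lemma exists_pos_le_half_mul_le_quarter (L : ℝ≥0) :
    ∃ δ : ℝ≥0, 0 < δ ∧ δ ≤ 1 / 2 ∧ δ * L ≤ 1 / 4 := by
  refine ⟨1 / (4 * (L + 1)), by positivity, ?_, ?_⟩
  · rw [← NNReal.coe_le_coe]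
    push_cast
    rw [div_le_div_iff₀ (by positivity) (by positivity)]
    have := L.2
    nlinarith
  · rw [← NNReal.coe_le_coe]
    push_cast
    rw [div_mul_eq_mul_div, div_le_div_iff₀ (by positivity) (by positivity)]
    have := L.2
    nlinarith

variable {d : ℕ} {V₀ : SmoothMap (Config d) ℝ} {L : ℝ≥0} (hL : LipschitzWith L (grad V₀))
include hL

/-- A strong control `u / τ` during the time `τ` approximates the shear of its potential. -/
lemma shear_controlPotential_mem_of_lipschitzWith {M : ℝ≥0} (hM4 : M ≤ 1 / 4)
    {u : Fin (d + 1) → ℝ} (hM : LipschitzWith M (grad (controlPotential u))) :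
    (0, shear (controlPotential u)) ∈ closure (reachable (euclideanHamiltonian V₀)) := by
  obtain ⟨δ, hδ0, hδ, hδL⟩ := exists_pos_le_half_mul_le_quarter L
  have hY := lipschitzWith_drivenField 0 hL hM hδ
    ((add_le_add hδL hM4).trans (by rw [← NNReal.coe_le_coe]; norm_num))
  have h0 := slice_zero_mem_closure_reachable hY hδ0 fun s hs => subset_closure <| by
    have e : (phaseTranslation (0, ((δ : ℝ) * Real.sin s)⁻¹ • (0 : Config d))).comp
        ((SmoothMap.slice (contDiff_endpoint hY) s).comp
          (phaseTranslation (-(0, ((δ : ℝ) * Real.sin s)⁻¹ • 0)))) =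
        SmoothMap.slice (contDiff_endpoint hY) s := by
      ext1 x
      simp [← Prod.zero_eq_mk]
    rw [← e]
    exact conj_slice_mem_reachable hY hs
  convert h0 using 2
  ext1 x
  have := endpoint_eq_add hY (s := 0) (x := x) (v := (0, -grad (controlPotential u) x.1))
    fun t => by simp [drivenField_apply]
  change _ = endpoint hY (0, x)
  rw [this, shear_apply]
  ext1 <;> simp [sub_eq_add_neg]

/-- The shear of `g_u` is the `N`-fold composition of the shear of `g_{u/N}`, so the smallness of
the Lipschitz constant is no restriction. -/
lemma shear_controlPotential_mem (u : Fin (d + 1) → ℝ) :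
    (0, shear (controlPotential u)) ∈ closure (reachable (euclideanHamiltonian V₀)) := by
  obtain ⟨M, hM⟩ := exists_lipschitzWith_grad_controlPotential u
  obtain ⟨N, hN⟩ := exists_nat_ge (4 * M)
  let v : Fin (d + 1) → ℝ := ((N : ℝ) + 1)⁻¹ • u
  have hv : LipschitzWith (‖((N : ℝ) + 1)⁻¹‖₊ * M) (grad (controlPotential v)) := by
    refine LipschitzWith.of_dist_le_mul fun x y => ?_
    simpa [v, grad_controlPotential_smul] using
      ((lipschitzWith_smul ((N : ℝ) + 1)⁻¹).comp hM).dist_le_mul x y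
  have hsmall : ‖((N : ℝ) + 1)⁻¹‖₊ * M ≤ 1 / 4 := by
    rw [← NNReal.coe_le_coe] at hN ⊢
    push_cast at hN ⊢
    rw [norm_inv, Real.norm_of_nonneg (by positivity), inv_mul_le_iff₀ (by positivity)]
    linarith
  have h1 := shear_controlPotential_mem_of_lipschitzWith hL hsmall hv
  have h2 : ∀ n : ℕ, (0, shear (controlPotential (((n : ℝ) + 1) • v))) ∈
      closure (reachable (euclideanHamiltonian V₀)) := by
    intro n
    induction n with
    | zero => simpa using h1
    | succ n ih =>
      have : (((n + 1 : ℕ) : ℝ) + 1) • v = ((n : ℝ) + 1) • v + v := by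
        push_cast
        rw [add_smul _ (1 : ℝ), one_smul]
      rw [this, controlPotential_add, shear_add]
      exact comp_mem_closure_reachable_zero ih h1
  have h3 := h2 N
  rwa [smul_smul, mul_inv_cancel₀ (by positivity), one_smul] at h3

lemma translate_momentum_mem (b : Config d) :
    (0, phaseTranslation (0, b)) ∈ closure (reachable (euclideanHamiltonian V₀)) := by
  let u : Fin (d + 1) → ℝ := Fin.snoc (fun j => -b j) 0
  have hu : linearPart u = -b := by
    ext j
    simp [linearPart, u]
  have hlast : u (Fin.last d) = 0 := by simp [u]
  have := shear_controlPotential_mem hL u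
  convert this using 2
  ext1 x
  ext1 <;> simp [grad_controlPotential, hu, hlast]

/-- A free flight of duration `τ` between momentum kicks by `a / τ` and `-a / τ` approximates the
translation of the position by `a`. -/
lemma translate_position_mem (a : Config d) :
    (0, phaseTranslation (a, 0)) ∈ closure (reachable (euclideanHamiltonian V₀)) := by
  obtain ⟨δ, hδ0, hδ, hδL⟩ := exists_pos_le_half_mul_le_quarter L
  have hgrad : ∀ q, grad (controlPotential (0 : Fin (d + 1) → ℝ)) q = 0 := fun q => by
    simpa using grad_controlPotential_smul 0 (0 : Fin (d + 1) → ℝ) q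
  have hM : LipschitzWith 0 (grad (controlPotential (0 : Fin (d + 1) → ℝ))) :=
    LipschitzWith.of_dist_le_mul fun x y => by simp [hgrad]
  have hY := lipschitzWith_drivenField a hL hM hδ
    ((add_le_add_left hδL 0).trans (by rw [← NNReal.coe_le_coe]; norm_num))
  have h0 := slice_zero_mem_closure_reachable hY hδ0 fun s hs => by
    have h1 := add_comp_mem_closure_reachable
      (add_comp_mem_closure_reachable
        (translate_momentum_mem hL (((δ : ℝ) * Real.sin s)⁻¹ • a))
        (subset_closure (conj_slice_mem_reachable hY hs)))
      (translate_momentum_mem hL (-(((δ : ℝ) * Real.sin s)⁻¹ • a)))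
    rw [zero_add, add_zero] at h1
    convert h1 using 2
    ext1 x
    simp [add_assoc, ← Prod.zero_eq_mk]
  convert h0 using 2
  ext1 x
  have := endpoint_eq_add hY (s := 0) (x := x) (v := (a, 0))
    fun t => by simp [drivenField_apply, hgrad]
  exact this.symm

/-- Conjugating with translations of the position moves the centre of the Gaussian. -/
lemma shear_gaussian_mul_exp_mem (f : SmoothMap (Config d) ℝ) (c : ℝ) (a : Config d)
    (hf : ∀ q, f q = c * gaussian d (q - a)) :
    (0, shear f) ∈ closure (reachable (euclideanHamiltonian V₀)) := by
  let u : Fin (d + 1) → ℝ := Fin.snoc (fun _ => 0) c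
  have hu : linearPart u = 0 := by
    ext j
    simp [linearPart, u]
  have hlast : u (Fin.last d) = c := by simp [u]
  have h1 := comp_mem_closure_reachable_zero (comp_mem_closure_reachable_zero
    (translate_position_mem hL (-a)) (shear_controlPotential_mem hL u))
    (translate_position_mem hL a)
  convert h1 using 2
  ext1 x
  have hg : grad f x.1 = grad (controlPotential u) (x.1 - a) := by
    refine grad_eq_of_hasFDerivAt ?_
    have e : f.toFun = fun q => controlPotential u (q - a) := by
      ext q
      rw [hf, controlPotential_apply, hu, hlast]
      simp
    rw [e]
    exact (hasFDerivAt_grad (controlPotential u) (x.1 - a)).comp x.1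
      ((hasFDerivAt_id x.1).sub_const a)
  ext1 <;> simp [hg, ← sub_eq_add_neg]

/-- Density of exponential sums, applied to the functions `h` for which the shear of
`e^{-|q|²/2} h` is reached in time zero. -/
theorem shear_mem_closure_reachable (f : SmoothMap (Config d) ℝ) :
    (0, shear f) ∈ closure (reachable (euclideanHamiltonian V₀)) := by
  let S : Set (SmoothMap (Config d) ℝ) :=
    {h | (0, shear ((gaussian d).mul h)) ∈ closure (reachable (euclideanHamiltonian V₀))}
  have hS : IsClosed S := isClosed_closure.preimage (continuous_const.prodMk
    (continuous_shear.comp (SmoothMap.continuous_mul.comp (continuous_const.prodMk continuous_id))))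
  have hadd : ∀ f ∈ S, ∀ g ∈ S, f.add g ∈ S := by
    intro f hf g hg
    have e : (gaussian d).mul (f.add g) = ((gaussian d).mul f).add ((gaussian d).mul g) := by
      ext q
      simp [mul_add]
    change (0, shear ((gaussian d).mul (f.add g))) ∈ closure _
    rw [e, shear_add]
    exact comp_mem_closure_reachable_zero hf hg
  have hexp : ∀ (c : ℝ) (a : Config d), ∃ g ∈ S, ∀ x, g x = c * Real.exp (inner ℝ a x) := by
    intro c a
    refine ⟨⟨fun x => c * Real.exp (inner ℝ a x), 
      contDiff_const.mul (contDiff_const.inner ℝ contDiff_id).exp⟩, ?_, fun x => rfl⟩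
    refine shear_gaussian_mul_exp_mem hL _ (c * Real.exp (‖a‖ ^ 2 / 2)) a fun q => ?_
    -- Completing the square: `-|q|²/2 + a·q = |a|²/2 - |q - a|²/2`.
    have e : -‖q‖ ^ 2 / 2 + inner ℝ a q = ‖a‖ ^ 2 / 2 + -‖q - a‖ ^ 2 / 2 := by
      rw [norm_sub_sq_real, real_inner_comm]
      ring
    simp only [SmoothMap.mul_apply, gaussian]
    rw [mul_left_comm, ← Real.exp_add, e, Real.exp_add, mul_assoc]
  have huniv := eq_univ_of_exp_mem hadd hexp hS
  have hpos : ContDiff ℝ ∞ fun q : Config d => Real.exp (‖q‖ ^ 2 / 2) :=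
    ((contDiff_norm_sq ℝ).div_const 2).exp
  have hmem : (⟨fun q => Real.exp (‖q‖ ^ 2 / 2) * f q, hpos.mul f.contDiff⟩ :
      SmoothMap (Config d) ℝ) ∈ S := huniv ▸ Set.mem_univ _
  convert (show (0, shear _) ∈ closure (reachable (euclideanHamiltonian V₀)) from hmem) using 3
  ext q
  simp only [SmoothMap.mul_apply, gaussian]
  rw [← mul_assoc, ← Real.exp_add]
  simp [neg_div]

end Generators

end

end

theorem theorem6p1 (d : ℕ) (V₀ : Config d → ℝ) (hV₀ : ContDiff ℝ ∞ V₀)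
    (hLip : ∃ L : ℝ≥0, LipschitzWith L (gradient V₀)) :
    verticalShears d ⊆ smallTimeApproxReachable (euclideanHamiltonian V₀) := by
  rintro _ ⟨f, hf, rfl⟩
  obtain ⟨L, hL⟩ := hLip
  have e : (fun x : Phase d => (x.1, x.2 - gradient f x.1)) = shear ⟨f, hf⟩ := by
    ext1 x
    rw [shear_apply]
    rfl
  rw [e]
  exact ⟨isHamiltonianDiffeo_shear _, fun ε hε K hK l => exists_isCloseOn_of_mem_closure
    (shear_mem_closure_reachable (V₀ := ⟨V₀, hV₀⟩) hL ⟨f, hf⟩) hε hK l⟩
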